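/- **Setting.** Let $K$ be a field of characteristic $\ne 2$, $G$ an abelian group, and $\varepsilon\colon G\times G\to K$ a commutation factor: $\varepsilon(\alpha,\beta)\varepsilon(\beta,\alpha)=1$, $\varepsilon(\alpha+\beta,\gamma)=\varepsilon(\alpha,\gamma)\varepsilon(\beta,\gamma)$, $\varepsilon(\alpha,\beta+\gamma)=\varepsilon(\alpha,\beta)\varepsilon(\alpha,\gamma)$. Put $G_{even}=\{\alpha:\varepsilon(\alpha,\alpha)=1\}$ and $G_{odd}=\{\alpha:\varepsilon(\alpha,\alpha)=-1\}$. Let $L=\bigoplus_{\alpha\in G}L_\alpha$ be a color Lie algebra over $K$ of finite (total) dimension: it has a bilinear bracket with $[L_\alpha,L_\beta]\subseteq L_{\alpha+\beta}$, $[x,y]=-\varepsilon(\alpha,\beta)[y,x]$ and $\varepsilon(\gamma,\alpha)[x,[y,z]]+\varepsilon(\alpha,\beta)[y,[z,x]]+\varepsilon(\beta,\gamma)[z,[x,y]]=0$ for $x\in L_\alpha$, $y\in L_\beta$, $z\in L_\gamma$. Let $M=\bigoplus_{\alpha\in G} M_\alpha$ be a color $L$-module of finite (total) dimension: $L_\alpha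 M_\beta\subseteq M_{\alpha+\beta}$ and $[x,y]m=x(ym)-\varepsilon(\alpha,\beta)\,y(xm)$ for $x\in L_\alpha$, $y\in L_\beta$, $m\in M$. Write $L_{even}=\bigoplus_{\alpha\in G_{even}}L_\alpha$, $L_{odd}=\bigoplus_{\alpha\in G_{odd}}L_\alpha$ and $S=\{\alpha\in G_{odd}:L_\alpha\ne0\}$. Let $C^n(L,M)_\gamma$ be the space of $n$-linear maps $f\colon L^n\to M$ with $f(L_{\alpha_1},\dots,L_{\alpha_n})\subseteq M_{\gamma+\alpha_1+\dots+\alpha_n}$ that are $\varepsilon$-skew-symmetric: exchanging adjacent homogeneous arguments $x_i,x_{i+1}$ of degrees $\alpha_i,\alpha_{i+1}$ multiplies the value by $-\varepsilon(\alpha_{i+1},\alpha_{i})$. The color Chevalley–Eilenberg differential is given for $f\in C^n(L,M)_\gamma$ and homogeneous $x_i\in L_{\alpha_i}$ by $$df(x_0,\dots,x_n)=\sum_{i}(-1)^i\varepsilon(\gamma+\alpha_0+\dots+\alpha_{i-1},\alpha_i)\,x_i f(x_0,\dots,\widehat{x_i},\dots,x_n)+\sum_{i<j}(-1)^j\varepsilon(\alpha_{i+1}+\dots+\alpha_{j-1},\alpha_j)\,f(x_0,\dots,x_{i-1},[x_i,x_j],x_{i+1},\dots,\widehat{x_j},\dots,x_n).$$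 Let $B^*$ be its coboundaries and $H^*(L,M)$ its cohomology; both are graded by $n\in\mathbb N$ and $\gamma\in G$. For an $\mathbb N$-graded $G$-graded space $V=\bigoplus_{n,\gamma}V_{\gamma,n}$ put $\dim_G V_n=\sum_\gamma(\dim V_{\gamma,n})e^\gamma$ and $\chi_G(V)=\lim_{t\to-1+0}\sum_{n\ge0}(\dim_G V_n)t^n$. It exists if, for each coefficient, the series converges for $|t|<1$ and the limit exists, the limits forming an element of the group ring $\mathbb R[G]$. Replacing $\dim_G$ by the ordinary dimension $\dim$, or by the superdimension $\dim_{\mathbb Z_2}$ (even degrees are sent to $1$ and odd ones to $\theta$ in $\mathbb R[\mathbb Z_2]=\mathbb R[\theta]/(\theta^2-1)$), gives $\chi(V)$ and $\chi_{\mathbb Z_2}(V)$. Write $\chi(L,M)=\chi(H^*(L,M))$, and similarly for $\chi_{\mathbb Z_2}$ and $\chi_G$. For $\alpha\in G$ of finite order $|\alpha|$ put $\overline\chi(\alpha)=\frac1{|\alpha|}\sum_{i=0}^{|\alpha|-1}(-1)^ie^{i\alpha}$. **Theorem.** 1. If $\chi(B^*)$ exists, then $\chi(L,M)$ exists and equals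 $0$ if $L_{even}\ne0$, and $\dfrac{\dim M}{2^{\dim L_{odd}}}$ if $L_{even}=0$. 2. If $\chi_{\mathbb Z_2}(B^*)$ exists and $\dim L_{even}\ge\dim L_{odd}$, then $\chi_{\mathbb Z_2}(L,M)$ exists and equals $0$ if $\dim L_{even}>\dim L_{odd}$, and $\left(\frac{1-\theta}2\right)^{|S|}\dim_{\mathbb Z_2}M$ if $\dim L_{even}=\dim L_{odd}$. 3. Suppose every $\alpha\in S$ has finite order (automatic if $G$ is finite). If $\chi_G(B^*)$ exists and $\dim L_0\ge\dim L_{odd}$, then $\chi_G(L,M)$ exists and equals $0$ if $\dim L_0>\dim L_{odd}$, and $$\prod_{0\ne\alpha\in G_{even}}(1-e^{-\alpha})^{\dim L_\alpha}\ \prod_{\alpha\in S}\overline\chi(\alpha)\ \dim_G M$$ if $\dim L_0=\dim L_{odd}$. -/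

import Mathlib

open Filter Topology

/-- A commutation factor on an abelian group `G` with values in a field `K`. -/
structure CommutationFactor (G K : Type*) [AddCommGroup G] [Field K] where
  toFun : G → G → K
  mul_swap : ∀ α β, toFun α β * toFun β α = 1
  add_left : ∀ α β γ, toFun (α + β) γ = toFun α γ * toFun β γ
  add_right : ∀ α β γ, toFun α (β + γ) = toFun α β * toFun α γ

instance {G K : Type*} [AddCommGroup G] [Field K] :
    CoeFun (CommutationFactor G K) (fun _ => G → G → K) :=
  ⟨CommutationFactor.toFun⟩

namespace CommutationFactor

variable {G K : Type*} [AddCommGroup G] [Field K] (ε : CommutationFactor G K)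

/-- The set `G_even`. -/
def even : Set G := {α | ε α α = 1}

/-- The set `G_odd`. -/
def odd : Set G := {α | ε α α = -1}

open Classical in
/-- The parity map `G → ℤ/2`, with fibres `G_even` over `0` and `G_odd` over `1`. -/
noncomputable def parity (α : G) : ZMod 2 := if α ∈ ε.even then 0 else 1

end CommutationFactor

/-- A `(G, ε)`-color Lie algebra structure on the vector space `L = ⨁ α, L_α`, where
`L_α` is `deg α`. -/
structure ColorLieAlgebra {G K : Type*} [AddCommGroup G] [Field K] (ε : CommutationFactor G K)
    (L : Type*) [AddCommGroup L] [Module K L] where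
  deg : G → Submodule K L
  indep : iSupIndep deg
  iSup_eq_top : ⨆ α, deg α = ⊤
  bracket : L →ₗ[K] L →ₗ[K] L
  bracket_mem : ∀ α β, ∀ x ∈ deg α, ∀ y ∈ deg β, bracket x y ∈ deg (α + β)
  skew : ∀ α β, ∀ x ∈ deg α, ∀ y ∈ deg β, bracket x y = -(ε α β • bracket y x)
  jacobi : ∀ α β γ, ∀ x ∈ deg α, ∀ y ∈ deg β, ∀ z ∈ deg γ,
    ε γ α • bracket x (bracket y z) + ε α β • bracket y (bracket z x) +
      ε β γ • bracket z (bracket x y) = 0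

namespace ColorLieAlgebra

variable {G K : Type*} [AddCommGroup G] [Field K] {ε : CommutationFactor G K}
  {L : Type*} [AddCommGroup L] [Module K L] (A : ColorLieAlgebra ε L)

/-- `L_even`. -/
def evenPart : Submodule K L := ⨆ α ∈ ε.even, A.deg α

/-- `L_odd`. -/
def oddPart : Submodule K L := ⨆ α ∈ ε.odd, A.deg α

/-- The odd degrees that occur in `L`. -/
def oddSupport : Set G := {α | α ∈ ε.odd ∧ A.deg α ≠ ⊥}

end ColorLieAlgebra

/-- A color module structure over the color Lie algebra `A` on the vector space
`M = ⨁ α, M_α`, where `M_α` is `deg α`. -/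
structure ColorModule {G K : Type*} [AddCommGroup G] [Field K] {ε : CommutationFactor G K}
    {L : Type*} [AddCommGroup L] [Module K L] (A : ColorLieAlgebra ε L)
    (M : Type*) [AddCommGroup M] [Module K M] where
  deg : G → Submodule K M
  indep : iSupIndep deg
  iSup_eq_top : ⨆ α, deg α = ⊤
  act : L →ₗ[K] M →ₗ[K] M
  act_mem : ∀ α β, ∀ x ∈ A.deg α, ∀ m ∈ deg β, act x m ∈ deg (α + β)
  act_bracket : ∀ α β, ∀ x ∈ A.deg α, ∀ y ∈ A.deg β, ∀ m,
    act (A.bracket x y) m = act x (act y m) - ε α β • act y (act x m)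

namespace ColorModule

variable {G K : Type*} [AddCommGroup G] [Field K] {ε : CommutationFactor G K}
  {L : Type*} [AddCommGroup L] [Module K L] {A : ColorLieAlgebra ε L}
  {M : Type*} [AddCommGroup M] [Module K M] (P : ColorModule A M)

/-- `C^n(L, M)_γ`: the `n`-linear `ε`-skew-symmetric maps `f` from `L` to `M` that are homogeneous
of degree `γ`, i.e. `f (L_{α_1}, …, L_{α_n}) ⊆ M_{γ + α_1 + ⋯ + α_n}`. -/
def cochains (n : ℕ) (γ : G) : Submodule K (MultilinearMap K (fun _ : Fin n => L) M) where
  carrier := {f | ∀ (α : Fin n → G) (x : Fin n → L), (∀ i, x i ∈ A.deg (α i)) →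
    f x ∈ P.deg (γ + ∑ i, α i) ∧
    ∀ i j : Fin n, j.val = i.val + 1 → f x = -(ε (α i) (α j) • f (x ∘ Equiv.swap i j))}
  zero_mem' := by
    intro α x _
    simp
  add_mem' := by
    intro f g hf hg α x hx
    refine ⟨add_mem (hf α x hx).1 (hg α x hx).1, fun i j hij => ?_⟩
    rw [add_apply, add_apply, (hf α x hx).2 i j hij,
      (hg α x hx).2 i j hij, smul_add, neg_add]
  smul_mem' := by
    intro c f hf α x hx
    refine ⟨Submodule.smul_mem _ c (hf α x hx).1, fun i j hij => ?_⟩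
    rw [smul_apply, smul_apply, (hf α x hx).2 i j hij,
      smul_neg, smul_comm]

/-- The value at homogeneous elements `x_0, …, x_n` of degrees `α_0, …, α_n` of the
Chevalley-Eilenberg differential of a cochain `f` of degree `γ`:
`∑_i (-1)^i ε(γ + α_0 + ⋯ + α_{i-1}, α_i) x_i · f(x_0, …, x̂_i, …, x_n)`
`+ ∑_{i<j} (-1)^j ε(α_{i+1} + ⋯ + α_{j-1}, α_j)`
`    f(x_0, …, x_{i-1}, [x_i, x_j], x_{i+1}, …, x̂_j, …, x_n)`. -/
def dValue {n : ℕ} (γ : G) (f : MultilinearMap K (fun _ : Fin n => L) M)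
    (α : Fin (n + 1) → G) (x : Fin (n + 1) → L) : M :=
  ∑ i, ((-1) ^ i.val * ε (γ + ∑ k ∈ Finset.Iio i, α k) (α i)) •
      P.act (x i) (f fun k => x (i.succAbove k)) +
    ∑ i, ∑ j ∈ Finset.Ioi i, ((-1) ^ j.val * ε (∑ k ∈ Finset.Ioo i j, α k) (α j)) •
      f fun k => if k.castSucc = i then A.bracket (x i) (x j) else x (j.succAbove k)

theorem dValue_zero {n : ℕ} (γ : G) (α : Fin (n + 1) → G) (x : Fin (n + 1) → L) :
    P.dValue γ (0 : MultilinearMap K (fun _ : Fin n => L) M) α x = 0 := by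
  simp [dValue]

theorem dValue_add {n : ℕ} (γ : G) (f g : MultilinearMap K (fun _ : Fin n => L) M)
    (α : Fin (n + 1) → G) (x : Fin (n + 1) → L) :
    P.dValue γ (f + g) α x = P.dValue γ f α x + P.dValue γ g α x := by
  simp only [dValue, add_apply, map_add, smul_add, Finset.sum_add_distrib]
  abel

theorem dValue_smul {n : ℕ} (γ : G) (c : K) (f : MultilinearMap K (fun _ : Fin n => L) M)
    (α : Fin (n + 1) → G) (x : Fin (n + 1) → L) :
    P.dValue γ (c • f) α x = c • P.dValue γ f α x := by
  simp only [dValue, smul_apply, map_smul, smul_add, Finset.smul_sum,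
    smul_comm c]

/-- `g` is the differential of the cochain `f` of degree `γ`. As the homogeneous elements span
`L`, the multilinear map `g` is determined by its values on them. -/
def IsDifferential {n : ℕ} (γ : G) (f : MultilinearMap K (fun _ : Fin n => L) M)
    (g : MultilinearMap K (fun _ : Fin (n + 1) => L) M) : Prop :=
  ∀ (α : Fin (n + 1) → G) (x : Fin (n + 1) → L), (∀ i, x i ∈ A.deg (α i)) →
    g x = P.dValue γ f α x

/-- The cocycles `Z^n_γ`: the cochains of degree `γ` whose differential is zero. -/
def cocycles (n : ℕ) (γ : G) : Submodule K (MultilinearMap K (fun _ : Fin n => L) M) where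
  carrier := {f | f ∈ P.cochains n γ ∧ P.IsDifferential γ f 0}
  zero_mem' := ⟨zero_mem _, fun α x _ => (P.dValue_zero γ α x).symm⟩
  add_mem' := by
    rintro f g ⟨hf, hf'⟩ ⟨hg, hg'⟩
    refine ⟨add_mem hf hg, fun α x hx => ?_⟩
    rw [dValue_add, ← hf' α x hx, ← hg' α x hx]
    simp
  smul_mem' := by
    rintro c f ⟨hf, hf'⟩
    refine ⟨Submodule.smul_mem _ c hf, fun α x hx => ?_⟩
    rw [dValue_smul, ← hf' α x hx]
    simp

/-- The coboundaries `B^n_γ`: zero for `n = 0`, and the differentials of the cochains in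
`C^{n-1}(L, M)_γ` otherwise. -/
def coboundaries : (n : ℕ) → (γ : G) → Submodule K (MultilinearMap K (fun _ : Fin n => L) M)
  | 0, _ => ⊥
  | n + 1, γ =>
    { carrier := {g | ∃ f ∈ P.cochains n γ, P.IsDifferential γ f g}
      zero_mem' := ⟨0, zero_mem _, fun α x _ => (P.dValue_zero γ α x).symm⟩
      add_mem' := by
        rintro g g' ⟨f, hf, h⟩ ⟨f', hf', h'⟩
        refine ⟨f + f', add_mem hf hf', fun α x hx => ?_⟩
        rw [dValue_add, ← h α x hx, ← h' α x hx, add_apply]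
      smul_mem' := by
        rintro c g ⟨f, hf, h⟩
        refine ⟨c • f, Submodule.smul_mem _ c hf, fun α x hx => ?_⟩
        rw [dValue_smul, ← h α x hx, smul_apply] }

/-- The cohomology `H^n(L, M)_γ`. -/
abbrev cohomology (n : ℕ) (γ : G) : Type _ :=
  P.cocycles n γ ⧸ (P.coboundaries n γ).submoduleOf (P.cocycles n γ)

/-- `dim B^n_γ`. -/
noncomputable def dimB (n : ℕ) (γ : G) : ℕ := Module.finrank K (P.coboundaries n γ)

/-- `dim H^n(L, M)_γ`. -/
noncomputable def dimH (n : ℕ) (γ : G) : ℕ := Module.finrank K (P.cohomology n γ)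

/-- The color dimension `dim_G M`. -/
noncomputable def colorDim : AddMonoidAlgebra ℝ G :=
  ∑ᶠ α, AddMonoidAlgebra.single α (Module.finrank K (P.deg α) : ℝ)

/-- The superdimension `dim_{ℤ/2} M`. -/
noncomputable def superDim : AddMonoidAlgebra ℝ (ZMod 2) :=
  ∑ᶠ α, AddMonoidAlgebra.single (ε.parity α) (Module.finrank K (P.deg α) : ℝ)

end ColorModule

/-- The power series `∑ a_n t^n` converges for `|t| < 1`, and its sum tends to `s` as
`t → -1 + 0`. -/
def HasAbelLimit (a : ℕ → ℕ) (s : ℝ) : Prop :=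
  (∀ t ∈ Set.Ioo (-1 : ℝ) 1, Summable fun n => (a n : ℝ) * t ^ n) ∧
    Tendsto (fun t : ℝ => ∑' n, (a n : ℝ) * t ^ n) (𝓝[>] (-1)) (𝓝 s)

/-- The element `c` of `ℝ[H]` is the Euler-Poincaré characteristic of an `ℕ`-graded `H`-color
vector space with `dim V_{β,n} = D n β`; the limit is taken componentwise. -/
def HasEulerChar {H : Type*} (D : ℕ → H → ℕ) (c : AddMonoidAlgebra ℝ H) : Prop :=
  ∀ β, HasAbelLimit (fun n => D n β) (c.coeff β)

/-- The graded dimensions after coarsening the grading along `p : G → H`. -/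
noncomputable def coarsen {G H : Type*} (p : G → H) (D : ℕ → G → ℕ) (n : ℕ) (β : H) : ℕ :=
  ∑ᶠ (α : G) (_ : p α = β), D n α

/-- The ordinary dimensions of the components of an `ℕ`-graded `G`-color vector space. -/
noncomputable def totalDim {G : Type*} (D : ℕ → G → ℕ) (n : ℕ) : ℕ := ∑ᶠ α : G, D n α

/-- `χ̄(α) = (1 / |α|) ∑_{i < |α|} (-1)^i e^{iα}`, for `α` of finite order `|α|`. -/
noncomputable def chiBar {G : Type*} [AddCommGroup G] (α : G) : AddMonoidAlgebra ℝ G :=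
  (1 / (addOrderOf α : ℝ)) • ∑ i ∈ Finset.range (addOrderOf α),
    AddMonoidAlgebra.single (i • α) ((-1 : ℝ) ^ i)

/-! Rank-nullity in the Chevalley-Eilenberg complex gives `dim C^n = dim H^n + dim B^n + dim
B^(n+1)` in each degree `γ`. Since `B^0 = 0`, the generating series satisfy `H(t) = C(t) - (1 + 1/t)
B(t)`. If `B(t)` has a finite limit as `t → -1`, the correction vanishes in the limit, so `H(t)`
inherits the limit of `C(t)`. It remains to compute `C(t)` (`finrank_cochains`,
`HasAbelLimit.of_eq_add`).

A cochain is determined by its values on sorted tuples of homogeneous basis vectors of `L`. Even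
vectors occur at most once and odd ones arbitrarily often (`cochains_eq_range`). Hence `C(t)` is
`dim_G M` times a factor `1 + t e^{-α}` for each even basis vector of degree `α` and a factor `1/(1
- t e^{-α})` for each odd one. If `α` is odd of order `m`, multiplying the latter by `1 - t^m`
leaves a polynomial. Here `m` is even, because `(-1)^m = ε(mα, α) = 1`, so `1 - t^m` has a simple
zero at `-1` and `(1 + t)/(1 - t^m) → 1/m`. The zeros of `C(t)` that cancel these poles come from
the even vectors of degree `0`. This explains the comparison of dimensions and the factors `χ̄(α)`;
these are idempotent, so only the set of odd degrees matters.

All three assertions are treated together by pushing the grading forward along a homomorphism `p : G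
→+ H`: to the trivial group, to `ℤ/2` by parity, and the identity of `G`. In the first case the
images have order `1`, each odd vector contributes `1/(1 - t)`, and there is no pole at `-1`.

That the differential maps cochains to cochains and squares to zero is proved by Cartan calculus. On
lists of vectors paired with degrees, `d` is defined by `ι_p d = L_p - d ι_p`, and the properties
needed follow by induction on the list. -/

/-! ### Commutation factors and the Jacobi identity. -/

namespace CommutationFactor

variable {G K : Type*} [AddCommGroup G] [Field K] (ε : CommutationFactor G K)

theorem ne_zero (α β : G) : ε α β ≠ 0 :=
  left_ne_zero_of_mul_eq_one (ε.mul_swap α β)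

theorem zero_left (β : G) : ε 0 β = 1 := by
  have h := ε.add_left 0 0 β
  rw [add_zero] at h
  exact (mul_eq_left₀ (ε.ne_zero 0 β)).mp h.symm

end CommutationFactor

namespace ColorLieAlgebra

variable {G K : Type*} [AddCommGroup G] [Field K] {ε : CommutationFactor G K}
  {L : Type*} [AddCommGroup L] [Module K L] (A : ColorLieAlgebra ε L)

/-- The bracket of two elements labelled by degrees. -/
def brk (p q : G × L) : G × L := (p.1 + q.1, A.bracket p.2 q.2)

@[simp] theorem brk_fst (p q : G × L) : (A.brk p q).1 = p.1 + q.1 := rfl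

@[simp] theorem brk_snd (p q : G × L) : (A.brk p q).2 = A.bracket p.2 q.2 := rfl

theorem brk_mem {p q : G × L} (hp : p.2 ∈ A.deg p.1) (hq : q.2 ∈ A.deg q.1) :
    (A.brk p q).2 ∈ A.deg (A.brk p q).1 :=
  A.bracket_mem _ _ _ hp _ hq

/-- The Jacobi identity solved for one iterated bracket, the form used when two Lie derivatives hit
the same argument. -/
theorem bracket_bracket {α β γ : G} {x y z : L} (hx : x ∈ A.deg α) (hy : y ∈ A.deg β)
    (hz : z ∈ A.deg γ) :
    A.bracket y (A.bracket x z) =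
      ε β α • A.bracket x (A.bracket y z) + (-ε β α) • A.bracket (A.bracket x y) z := by
  have hj := A.jacobi α β γ x hx y hy z hz
  rw [A.skew γ α z hz x hx, A.skew γ (α + β) z hz _ (A.bracket_mem _ _ _ hx _ hy)] at hj
  have h1 := ε.mul_swap α β
  have h2 := ε.mul_swap β γ
  -- Skew-symmetry moves `z` to the right in every term; the common factor `ε γ α` is nonzero and
  -- can be cancelled.
  have key : ε γ α • (A.bracket x (A.bracket y z) - ε α β • A.bracket y (A.bracket x z)
      - A.bracket (A.bracket x y) z) = 0 := by
    rw [← hj, ε.add_right, map_neg, map_smul]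
    have : ε β γ * (ε γ α * ε γ β) = ε γ α := by linear_combination ε γ α * h2
    simp only [smul_sub, smul_neg, smul_smul, this, mul_comm (ε γ α) (ε α β)]
    abel
  have key' := (smul_eq_zero.mp key).resolve_left (ε.ne_zero _ _)
  have h4 : A.bracket (A.bracket x y) z = A.bracket x (A.bracket y z)
      - ε α β • A.bracket y (A.bracket x z) := (sub_eq_zero.mp key').symm
  rw [h4, neg_smul, smul_sub, smul_smul, mul_comm, h1, one_smul]
  abel

end ColorLieAlgebra

/-- A function of lists of labelled vectors that is linear in every entry. -/
structure IsListMultilinear {G L M : Type*} (K : Type*) [Field K] [AddCommGroup L] [Module K L]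
    [AddCommGroup M] [Module K M] (F : List (G × L) → M) : Prop where
  add : ∀ l α x y r, F (l ++ (α, x + y) :: r) = F (l ++ (α, x) :: r) + F (l ++ (α, y) :: r)
  smul : ∀ l α (c : K) x r, F (l ++ (α, c • x) :: r) = c • F (l ++ (α, x) :: r)

namespace IsListMultilinear

variable {G K L M : Type*} [Field K] [AddCommGroup L] [Module K L]
    [AddCommGroup M] [Module K M] {F : List (G × L) → M}

theorem cons (hF : IsListMultilinear K F) (p : G × L) :
    IsListMultilinear K fun l => F (p :: l) :=
  ⟨fun l => hF.add (p :: l), fun l => hF.smul (p :: l)⟩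

theorem head_add (hF : IsListMultilinear K F) (α : G) (x y : L) (r : List (G × L)) :
    F ((α, x + y) :: r) = F ((α, x) :: r) + F ((α, y) :: r) := hF.add [] α x y r

theorem head_smul (hF : IsListMultilinear K F) (α : G) (c : K) (x : L) (r : List (G × L)) :
    F ((α, c • x) :: r) = c • F ((α, x) :: r) := hF.smul [] α c x r

end IsListMultilinear

/-! ### Cartan calculus on labelled lists. -/

namespace ColorModule

variable {G K : Type*} [AddCommGroup G] [Field K] {ε : CommutationFactor G K}
  {L : Type*} [AddCommGroup L] [Module K L] {A : ColorLieAlgebra ε L}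
  {M : Type*} [AddCommGroup M] [Module K M] (P : ColorModule A M)

/-- The part of the Lie derivative in which `p` acts on the arguments. -/
def argAction (A : ColorLieAlgebra ε L) (p : G × L) : List (G × L) → (List (G × L) → M) → M
  | [], _ => 0
  | y :: ys, F => F (A.brk p y :: ys) + ε p.1 y.1 • argAction A p ys fun l => F (y :: l)

/-- The Lie derivative along `p` of a cochain of degree `γ`, multiplied by `ε γ p.1`. -/
def lieDeriv (γ : G) (p : G × L) (F : List (G × L) → M) (ys : List (G × L)) : M :=
  ε γ p.1 • P.act p.2 (F ys) - argAction A p ys F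

/-- The Chevalley-Eilenberg differential, defined through Cartan's formula. -/
def listD : List (G × L) → G → (List (G × L) → M) → M
  | [], _, _ => 0
  | p :: ys, γ, F => P.lieDeriv γ p F ys - listD ys (γ + p.1) fun l => F (p :: l)

theorem argAction_add (p : G × L) (ys : List (G × L)) (F F' : List (G × L) → M) :
    argAction A p ys (fun l => F l + F' l) = argAction A p ys F + argAction A p ys F' := by
  induction ys generalizing F F' with
  | nil => simp [argAction]
  | cons y ys ih => simp only [argAction, ih, smul_add]; abel

theorem argAction_smul (p : G × L) (ys : List (G × L)) (c : K) (F : List (G × L) → M) :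
    argAction A p ys (fun l => c • F l) = c • argAction A p ys F := by
  induction ys generalizing F with
  | nil => simp [argAction]
  | cons y ys ih => simp only [argAction, ih, smul_add, smul_comm c]

theorem lieDeriv_add (γ : G) (p : G × L) (ys : List (G × L)) (F F' : List (G × L) → M) :
    P.lieDeriv γ p (fun l => F l + F' l) ys = P.lieDeriv γ p F ys + P.lieDeriv γ p F' ys := by
  simp only [lieDeriv, argAction_add, map_add, smul_add]; abel

theorem lieDeriv_smul (γ : G) (p : G × L) (ys : List (G × L)) (c : K) (F : List (G × L) → M) :
    P.lieDeriv γ p (fun l => c • F l) ys = c • P.lieDeriv γ p F ys := by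
  simp only [lieDeriv, argAction_smul, map_smul, smul_sub, smul_comm c]

theorem lieDeriv_sub (γ : G) (p : G × L) (ys : List (G × L)) (F F' : List (G × L) → M) :
    P.lieDeriv γ p (fun l => F l - F' l) ys = P.lieDeriv γ p F ys - P.lieDeriv γ p F' ys := by
  have := P.lieDeriv_add γ p ys F (fun l => (-1 : K) • F' l)
  rw [P.lieDeriv_smul] at this
  simpa only [neg_smul, one_smul, ← sub_eq_add_neg] using this

theorem listD_add (ys : List (G × L)) (γ : G) (F F' : List (G × L) → M) :
    P.listD ys γ (fun l => F l + F' l) = P.listD ys γ F + P.listD ys γ F' := by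
  induction ys generalizing γ F F' with
  | nil => simp [listD]
  | cons y ys ih => simp only [listD, ih, lieDeriv_add]; abel

theorem listD_smul (ys : List (G × L)) (γ : G) (c : K) (F : List (G × L) → M) :
    P.listD ys γ (fun l => c • F l) = c • P.listD ys γ F := by
  induction ys generalizing γ F with
  | nil => simp [listD]
  | cons y ys ih => simp only [listD, ih, lieDeriv_smul, smul_sub]

theorem listD_sub (ys : List (G × L)) (γ : G) (F F' : List (G × L) → M) :
    P.listD ys γ (fun l => F l - F' l) = P.listD ys γ F - P.listD ys γ F' := by
  have := P.listD_add ys γ F (fun l => (-1 : K) • F' l)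
  rw [P.listD_smul] at this
  simpa only [neg_smul, one_smul, ← sub_eq_add_neg] using this

/-- The commutation of `L_p` with the contraction by `y`. The contracted cochain has degree `γ +
y.1`, and the extra factor `ε y.1 p.1` in its normalization is undone by `ε p.1 y.1`. -/
theorem lieDeriv_cons (γ : G) (p y : G × L) (F : List (G × L) → M) (ys : List (G × L)) :
    P.lieDeriv γ p F (y :: ys) =
      ε p.1 y.1 • P.lieDeriv (γ + y.1) p (fun l => F (y :: l)) ys - F (A.brk p y :: ys) := by
  have h : ε p.1 y.1 * (ε γ p.1 * ε y.1 p.1) = ε γ p.1 := by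
    linear_combination ε γ p.1 * ε.mul_swap p.1 y.1
  simp only [lieDeriv, argAction, ε.add_left, smul_sub, smul_smul, h]
  abel

/-- The commutator of two Lie derivatives. -/
theorem lieDeriv_lieDeriv {F : List (G × L) → M} (hF : IsListMultilinear K F) (γ : G)
    {p y : G × L} (hp : p.2 ∈ A.deg p.1) (hy : y.2 ∈ A.deg y.1) {ys : List (G × L)}
    (hys : ∀ z ∈ ys, z.2 ∈ A.deg z.1) :
    P.lieDeriv (γ + y.1) p (P.lieDeriv γ y F) ys =
      ε y.1 p.1 • (P.lieDeriv (γ + p.1) y (P.lieDeriv γ p F) ys +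
        P.lieDeriv γ (A.brk p y) F ys) := by
  have hpy := ε.mul_swap p.1 y.1
  induction ys generalizing F γ with
  | nil =>
    -- Without arguments the commutator is the module axiom.
    have hb := P.act_bracket _ _ _ hp _ hy (F [])
    simp only [lieDeriv, argAction, sub_zero, A.brk_fst, A.brk_snd, hb, ε.add_left, ε.add_right,
      map_smul, smul_smul, smul_sub, smul_add]
    have h1 : ε y.1 p.1 * (ε γ p.1 * ε γ y.1 * ε p.1 y.1) =
      ε y.1 p.1 * (ε γ y.1 * ε p.1 y.1 * ε γ p.1) := by ring
    have h2 : ε y.1 p.1 * (ε γ p.1 * ε γ y.1) = ε γ p.1 * ε y.1 p.1 * ε γ y.1 := by ring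
    rw [h1, h2]
    abel
  | cons z ys ih =>
    have hz : z.2 ∈ A.deg z.1 := hys z (by simp)
    have hys' : ∀ w ∈ ys, w.2 ∈ A.deg w.1 := fun w hw => hys w (by simp [hw])
    have hb := A.bracket_bracket hp hy hz
    -- Both elements act on the head `z` in this term; here the Jacobi identity enters. The labels
    -- must be rearranged too, since `F` depends on them.
    have key : F (A.brk y (A.brk p z) :: ys) = ε y.1 p.1 • F (A.brk p (A.brk y z) :: ys)
        + (-ε y.1 p.1) • F (A.brk (A.brk p y) z :: ys) := by
      simp only [ColorLieAlgebra.brk, hb, hF.head_add, hF.head_smul]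
      rw [add_left_comm y.1 p.1 z.1, add_assoc p.1 y.1 z.1]
    have ih' := ih (hF.cons z) (γ + z.1) hys'
    rw [add_right_comm γ z.1 y.1, add_right_comm γ z.1 p.1] at ih'
    rw [P.lieDeriv_cons (γ + y.1) p z, P.lieDeriv_cons (γ + p.1) y z,
      P.lieDeriv_cons γ (A.brk p y) z, P.lieDeriv_cons γ y (A.brk p z),
      P.lieDeriv_cons γ p (A.brk y z), key]
    simp only [P.lieDeriv_cons γ y z, P.lieDeriv_cons γ p z]
    rw [P.lieDeriv_sub, P.lieDeriv_sub, P.lieDeriv_smul, P.lieDeriv_smul, ih']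
    simp only [A.brk_fst, smul_add, smul_sub, smul_smul, ε.add_left, ε.add_right, ← add_assoc,
      neg_smul]
    have e1 : ε y.1 p.1 * (ε p.1 y.1 * ε p.1 z.1) = ε p.1 z.1 := by
      linear_combination ε p.1 z.1 * hpy
    simp only [e1]
    simp only [mul_comm, mul_left_comm]
    abel

theorem listD_cons (p : G × L) (ys : List (G × L)) (γ : G) (F : List (G × L) → M) :
    P.listD (p :: ys) γ F = P.lieDeriv γ p F ys - P.listD ys (γ + p.1) fun l => F (p :: l) := rfl

/-- `L_p` commutes with `d`. After contraction with the head `y`, the commutator of `L_p` and `L_y`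
produces the Lie derivative along `[p, y]`, which cancels the one arising when `p` acts on `y`. -/
theorem lieDeriv_listD {F : List (G × L) → M} (hF : IsListMultilinear K F) (γ : G)
    {p : G × L} (hp : p.2 ∈ A.deg p.1) {ys : List (G × L)} (hys : ∀ z ∈ ys, z.2 ∈ A.deg z.1) :
    P.lieDeriv γ p (fun l => P.listD l γ F) ys = P.listD ys (γ + p.1) (P.lieDeriv γ p F) := by
  induction ys generalizing F γ with
  | nil => simp [lieDeriv, listD, argAction]
  | cons y ys ih =>
    have hy : y.2 ∈ A.deg y.1 := hys y (by simp)
    have hys' : ∀ w ∈ ys, w.2 ∈ A.deg w.1 := fun w hw => hys w (by simp [hw])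
    have hpy := ε.mul_swap p.1 y.1
    rw [P.lieDeriv_cons]
    simp only [P.listD_cons]
    rw [P.lieDeriv_sub, ih (hF.cons y) (γ + y.1) hys', P.lieDeriv_lieDeriv hF γ hp hy hys']
    simp only [P.lieDeriv_cons γ p y]
    rw [P.listD_sub, P.listD_smul]
    simp only [smul_sub, smul_smul, hpy, one_smul, A.brk_fst, ← add_assoc,
      add_right_comm γ y.1 p.1]
    abel

/-- By Cartan's formula `ι_y d d = L_y d - d ι_y d = L_y d - d L_y + d d ι_y`. The first two terms
cancel, and the last vanishes by induction on the list. -/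
theorem listD_listD {F : List (G × L) → M} (hF : IsListMultilinear K F) (γ : G)
    {ys : List (G × L)} (hys : ∀ z ∈ ys, z.2 ∈ A.deg z.1) :
    P.listD ys γ (fun l => P.listD l γ F) = 0 := by
  induction ys generalizing F γ with
  | nil => rfl
  | cons y ys ih =>
    have hy : y.2 ∈ A.deg y.1 := hys y (by simp)
    have hys' : ∀ w ∈ ys, w.2 ∈ A.deg w.1 := fun w hw => hys w (by simp [hw])
    rw [P.listD_cons, P.lieDeriv_listD hF γ hy hys']
    simp only [P.listD_cons]
    rw [P.listD_sub, ih (hF.cons y) _ hys']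
    abel

end ColorModule

/-- A function of lists of labelled vectors is `ε`-skew-symmetric on homogeneous vectors. -/
def IsListSkew {G K L M : Type*} [AddCommGroup G] [Field K] {ε : CommutationFactor G K}
    [AddCommGroup L] [Module K L] [AddCommGroup M] [Module K M] (A : ColorLieAlgebra ε L)
    (F : List (G × L) → M) : Prop :=
  ∀ l p q r, (∀ z ∈ l ++ p :: q :: r, z.2 ∈ A.deg z.1) →
    F (l ++ p :: q :: r) = -(ε p.1 q.1 • F (l ++ q :: p :: r))

/-! ### Multilinearity, homogeneity and skew-symmetry of the Lie derivative and of `d`. -/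

namespace ColorModule

variable {G K : Type*} [AddCommGroup G] [Field K] {ε : CommutationFactor G K}
  {L : Type*} [AddCommGroup L] [Module K L] {A : ColorLieAlgebra ε L}
  {M : Type*} [AddCommGroup M] [Module K M] (P : ColorModule A M)

/-- A function of lists of labelled vectors is homogeneous of degree `γ`. -/
def IsListHomogeneous (γ : G) (F : List (G × L) → M) : Prop :=
  ∀ l, (∀ z ∈ l, z.2 ∈ A.deg z.1) → F l ∈ P.deg (γ + (l.map Prod.fst).sum)

section Multilinear

theorem argAction_label_add {F : List (G × L) → M} (hF : IsListMultilinear K F) (α : G)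
    (x y : L) (ys : List (G × L)) :
    argAction A (α, x + y) ys F = argAction A (α, x) ys F + argAction A (α, y) ys F := by
  induction ys generalizing F with
  | nil => simp [argAction]
  | cons z ys ih =>
    simp only [argAction, ColorLieAlgebra.brk, map_add, LinearMap.add_apply, hF.head_add,
      ih (hF.cons z), smul_add]
    abel

theorem argAction_label_smul {F : List (G × L) → M} (hF : IsListMultilinear K F) (α : G)
    (c : K) (x : L) (ys : List (G × L)) :
    argAction A (α, c • x) ys F = c • argAction A (α, x) ys F := by
  induction ys generalizing F with
  | nil => simp [argAction]
  | cons z ys ih =>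
    simp only [argAction, ColorLieAlgebra.brk, map_smul, LinearMap.smul_apply, hF.head_smul,
      ih (hF.cons z), smul_add, smul_comm c]

theorem argAction_arg_add {F : List (G × L) → M} (hF : IsListMultilinear K F) (p : G × L)
    (l : List (G × L)) (α : G) (x y : L) (r : List (G × L)) :
    argAction A p (l ++ (α, x + y) :: r) F =
      argAction A p (l ++ (α, x) :: r) F + argAction A p (l ++ (α, y) :: r) F := by
  induction l generalizing F with
  | nil =>
    simp only [argAction, List.nil_append, argAction_add, ColorLieAlgebra.brk, map_add,
      hF.head_add, smul_add]
    abel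
  | cons z l ih =>
    have := hF.add (A.brk p z :: l) α x y r
    simp only [List.cons_append] at this
    simp only [argAction, List.cons_append, ih (hF.cons z), smul_add, this]
    abel

theorem argAction_arg_smul {F : List (G × L) → M} (hF : IsListMultilinear K F) (p : G × L)
    (l : List (G × L)) (α : G) (c : K) (x : L) (r : List (G × L)) :
    argAction A p (l ++ (α, c • x) :: r) F = c • argAction A p (l ++ (α, x) :: r) F := by
  induction l generalizing F with
  | nil =>
    simp only [argAction, List.nil_append, argAction_smul, ColorLieAlgebra.brk, map_smul,
      hF.head_smul, smul_add, smul_comm c]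
  | cons z l ih =>
    have := hF.smul (A.brk p z :: l) α c x r
    simp only [List.cons_append] at this
    simp only [argAction, List.cons_append, ih (hF.cons z), smul_add, this, smul_comm c]

theorem isListMultilinear_lieDeriv {F : List (G × L) → M} (hF : IsListMultilinear K F) (γ : G)
    (p : G × L) : IsListMultilinear K (P.lieDeriv γ p F) where
  add l α x y r := by
    simp only [lieDeriv, hF.add, argAction_arg_add hF, map_add, smul_add]; abel
  smul l α c x r := by
    simp only [lieDeriv, hF.smul, argAction_arg_smul hF, map_smul, smul_sub, smul_comm c]

theorem isListMultilinear_listD {F : List (G × L) → M} (hF : IsListMultilinear K F) (γ : G) :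
    IsListMultilinear K fun l => P.listD l γ F where
  add l α x y r := by
    induction l generalizing F γ with
    | nil =>
      have h : (fun l => F ((α, x + y) :: l)) = fun l => F ((α, x) :: l) + F ((α, y) :: l) :=
        funext fun l => hF.head_add α x y l
      simp only [List.nil_append, listD, h, listD_add, lieDeriv, argAction_label_add hF, map_add,
        LinearMap.add_apply, smul_add]
      abel
    | cons z l ih =>
      simp only [List.cons_append, listD, ih (hF.cons z),
        (P.isListMultilinear_lieDeriv hF γ z).add]
      abel
  smul l α c x r := by
    induction l generalizing F γ with
    | nil =>
      have h : (fun l => F ((α, c • x) :: l)) = fun l => c • F ((α, x) :: l) :=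
        funext fun l => hF.head_smul α c x l
      simp only [List.nil_append, listD, h, listD_smul, lieDeriv, argAction_label_smul hF,
        map_smul, LinearMap.smul_apply, smul_sub, smul_comm c]
    | cons z l ih =>
      simp only [List.cons_append, listD, ih (hF.cons z),
        (P.isListMultilinear_lieDeriv hF γ z).smul, smul_sub]

end Multilinear

section Homogeneous

variable {P}

theorem IsListHomogeneous.cons {γ : G} {F : List (G × L) → M} (hF : P.IsListHomogeneous γ F)
    {p : G × L} (hp : p.2 ∈ A.deg p.1) :
    P.IsListHomogeneous (γ + p.1) fun l => F (p :: l) := by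
  intro l hl
  have := hF (p :: l) (List.forall_mem_cons.mpr ⟨hp, hl⟩)
  simpa [add_assoc] using this

theorem IsListHomogeneous.argAction {γ : G} {F : List (G × L) → M}
    (hF : P.IsListHomogeneous γ F) {p : G × L} (hp : p.2 ∈ A.deg p.1) :
    P.IsListHomogeneous (γ + p.1) fun l => argAction A p l F := by
  intro l hl
  induction l generalizing F γ with
  | nil => simp [ColorModule.argAction]
  | cons y l ih =>
    obtain ⟨hy, hl'⟩ := List.forall_mem_cons.mp hl
    refine add_mem ?_ (Submodule.smul_mem _ _ ?_)
    · have := hF (A.brk p y :: l) (List.forall_mem_cons.mpr ⟨A.brk_mem hp hy, hl'⟩)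
      simpa [add_assoc] using this
    · have := ih (hF.cons hy) hl'
      simpa [add_assoc, add_left_comm] using this

theorem IsListHomogeneous.lieDeriv {γ : G} {F : List (G × L) → M}
    (hF : P.IsListHomogeneous γ F) {p : G × L} (hp : p.2 ∈ A.deg p.1) :
    P.IsListHomogeneous (γ + p.1) (P.lieDeriv γ p F) := by
  intro l hl
  refine sub_mem (Submodule.smul_mem _ _ ?_) (hF.argAction hp l hl)
  have := P.act_mem _ _ _ hp _ (hF l hl)
  rwa [← add_assoc, add_comm p.1] at this

theorem IsListHomogeneous.listD {γ : G} {F : List (G × L) → M}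
    (hF : P.IsListHomogeneous γ F) : P.IsListHomogeneous γ fun l => P.listD l γ F := by
  intro l hl
  induction l generalizing F γ with
  | nil => exact zero_mem _
  | cons y l ih =>
    obtain ⟨hy, hl'⟩ := List.forall_mem_cons.mp hl
    rw [List.map_cons, List.sum_cons, ← add_assoc]
    exact sub_mem (hF.lieDeriv hy l hl') (ih (hF.cons hy) hl')

end Homogeneous

section Skew

theorem _root_.IsListSkew.cons {F : List (G × L) → M} (hF : IsListSkew A F) {p : G × L}
    (hp : p.2 ∈ A.deg p.1) : IsListSkew A fun l => F (p :: l) :=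
  fun l q q' r h => hF (p :: l) q q' r (List.forall_mem_cons.mpr ⟨hp, h⟩)

theorem _root_.IsListSkew.head_swap {F : List (G × L) → M} (hF : IsListSkew A F) {p q : G × L}
    (hp : p.2 ∈ A.deg p.1) (hq : q.2 ∈ A.deg q.1) {r : List (G × L)}
    (hr : ∀ z ∈ r, z.2 ∈ A.deg z.1) :
    F (p :: q :: r) = -(ε p.1 q.1 • F (q :: p :: r)) :=
  hF [] p q r (List.forall_mem_cons.mpr ⟨hp, List.forall_mem_cons.mpr ⟨hq, hr⟩⟩)

theorem lieDeriv_congr (γ : G) {p : G × L} (hp : p.2 ∈ A.deg p.1) {F F' : List (G × L) → M}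
    {ys : List (G × L)} (hys : ∀ z ∈ ys, z.2 ∈ A.deg z.1)
    (h : ∀ l, l.length = ys.length → (∀ z ∈ l, z.2 ∈ A.deg z.1) → F l = F' l) :
    P.lieDeriv γ p F ys = P.lieDeriv γ p F' ys := by
  have key : argAction A p ys F = argAction A p ys F' := by
    induction ys generalizing F F' with
    | nil => rfl
    | cons y ys ih =>
      obtain ⟨hy, hys'⟩ := List.forall_mem_cons.mp hys
      rw [argAction, argAction,
        h (A.brk p y :: ys) rfl (List.forall_mem_cons.mpr ⟨A.brk_mem hp hy, hys'⟩),
        ih hys' fun l hn hl => h (y :: l) (congrArg (· + 1) hn)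
          (List.forall_mem_cons.mpr ⟨hy, hl⟩)]
  rw [lieDeriv, lieDeriv, h ys rfl hys, key]

/-- `d` evaluates its cochain only on homogeneous lists with one entry fewer. Functions that agree
there may thus be interchanged, even if they differ on other lists. -/
theorem listD_congr (γ : G) {F F' : List (G × L) → M}
    {ys : List (G × L)} (hys : ∀ z ∈ ys, z.2 ∈ A.deg z.1)
    (h : ∀ l, l.length + 1 = ys.length → (∀ z ∈ l, z.2 ∈ A.deg z.1) → F l = F' l) :
    P.listD ys γ F = P.listD ys γ F' := by
  induction ys generalizing F F' γ with
  | nil => rfl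
  | cons y ys ih =>
    obtain ⟨hy, hys'⟩ := List.forall_mem_cons.mp hys
    rw [listD, listD, P.lieDeriv_congr γ hy hys' fun l hn => h l (congrArg (· + 1) hn),
      ih _ hys' fun l hn hl => h (y :: l) (congrArg (· + 1) hn) (List.forall_mem_cons.mpr ⟨hy, hl⟩)]

theorem isListSkew_lieDeriv {F : List (G × L) → M} (hF : IsListSkew A F) (γ : G)
    {p : G × L} (hp : p.2 ∈ A.deg p.1) : IsListSkew A (P.lieDeriv γ p F) := by
  intro l q q' r h
  induction l generalizing F γ with
  | nil =>
    simp only [List.nil_append] at h ⊢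
    obtain ⟨hq, h⟩ := List.forall_mem_cons.mp h
    obtain ⟨hq', hr⟩ := List.forall_mem_cons.mp h
    have hpq := ε.mul_swap p.1 q.1
    have hs : P.lieDeriv (γ + q.1 + q'.1) p (fun l => F (q :: q' :: l)) r =
        (-ε q.1 q'.1) • P.lieDeriv (γ + q'.1 + q.1) p (fun l => F (q' :: q :: l)) r := by
      rw [← P.lieDeriv_smul, add_right_comm]
      refine P.lieDeriv_congr _ hp hr fun l _ hl => ?_
      rw [neg_smul]
      exact hF.head_swap hq hq' hl
    rw [P.lieDeriv_cons, P.lieDeriv_cons, P.lieDeriv_cons, P.lieDeriv_cons, hs,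
      hF.head_swap hq (A.brk_mem hp hq') hr, hF.head_swap (A.brk_mem hp hq) hq' hr]
    simp only [A.brk_fst, ε.add_left, ε.add_right, smul_sub, smul_neg, smul_smul, neg_smul]
    have e1 : ε p.1 q.1 * (ε q.1 p.1 * ε q.1 q'.1) = ε q.1 q'.1 := by
      linear_combination ε q.1 q'.1 * hpq
    have e2 : ε q.1 q'.1 * ε p.1 q'.1 = ε p.1 q'.1 * ε q.1 q'.1 := mul_comm _ _
    have e3 : ε p.1 q.1 * (ε p.1 q'.1 * ε q.1 q'.1) = ε q.1 q'.1 * (ε p.1 q'.1 * ε p.1 q.1) := by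
      ring
    rw [e1, e2, e3]
    abel
  | cons z l ih =>
    rw [List.cons_append] at h
    obtain ⟨hz, h'⟩ := List.forall_mem_cons.mp h
    have hsw : F (A.brk p z :: (l ++ q :: q' :: r)) =
        -(ε q.1 q'.1 • F (A.brk p z :: (l ++ q' :: q :: r))) :=
      hF (A.brk p z :: l) q q' r (List.forall_mem_cons.mpr ⟨A.brk_mem hp hz, h'⟩)
    simp only [List.cons_append]
    rw [P.lieDeriv_cons, P.lieDeriv_cons, ih (hF.cons hz) _ h', hsw]
    simp only [smul_sub, smul_neg, smul_comm (ε p.1 z.1)]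
    abel

/-- If the swap is deeper in the list, Cartan's formula reduces it to `L_z` and to a shorter list.
If it is at the head, two contractions give two Lie derivative terms that are exchanged, a bracket
term governed by skew-symmetry in `A`, and a double contraction governed by that of `F`. -/
theorem isListSkew_listD {F : List (G × L) → M} (hF : IsListSkew A F)
    (hF' : IsListMultilinear K F) (γ : G) : IsListSkew A fun l => P.listD l γ F := by
  intro l q q' r h
  induction l generalizing F γ with
  | nil =>
    simp only [List.nil_append] at h ⊢
    obtain ⟨hq, h⟩ := List.forall_mem_cons.mp h
    obtain ⟨hq', hr⟩ := List.forall_mem_cons.mp h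
    have hqq := ε.mul_swap q.1 q'.1
    have hs : P.listD r (γ + q.1 + q'.1) (fun l => F (q :: q' :: l)) =
        (-ε q.1 q'.1) • P.listD r (γ + q'.1 + q.1) (fun l => F (q' :: q :: l)) := by
      rw [← P.listD_smul, add_right_comm]
      refine P.listD_congr _ hr fun l _ hl => ?_
      rw [neg_smul]
      exact hF.head_swap hq hq' hl
    have hb : F (A.brk q q' :: r) = (-ε q.1 q'.1) • F (A.brk q' q :: r) := by
      simp only [ColorLieAlgebra.brk]
      rw [A.skew _ _ _ hq _ hq', ← neg_smul, hF'.head_smul, add_comm]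
    rw [P.listD_cons, P.listD_cons, P.listD_cons, P.listD_cons, P.lieDeriv_cons, P.lieDeriv_cons,
      hs, hb]
    simp only [smul_sub, smul_smul, neg_smul, hqq, one_smul]
    abel
  | cons z l ih =>
    rw [List.cons_append] at h
    obtain ⟨hz, h'⟩ := List.forall_mem_cons.mp h
    have ih' := ih (hF.cons hz) (hF'.cons z) (γ + z.1) h'
    simp only [List.cons_append] at ih' ⊢
    rw [P.listD_cons, P.listD_cons, P.isListSkew_lieDeriv hF γ hz l q q' r h', ih', smul_sub]
    abel

end Skew

end ColorModule

/-- A multilinear map in `n` variables as a function of lists, zero on lists of length `≠ n`. -/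
def MultilinearMap.listFn {G K L M : Type*} [Field K] [AddCommGroup L] [Module K L]
    [AddCommGroup M] [Module K M] {n : ℕ} (f : MultilinearMap K (fun _ : Fin n => L) M)
    (l : List (G × L)) : M :=
  if h : l.length = n then f fun i => (l.get (i.cast h.symm)).2 else 0

/-! ### Multilinear maps as functions of lists, and the explicit formula for the differential. -/

namespace MultilinearMap

variable {G K L M : Type*} [Field K] [AddCommGroup L] [Module K L]
    [AddCommGroup M] [Module K M] {n : ℕ}

theorem _root_.List.exists_eq_ofFn {X : Type*} {l : List X} {n : ℕ} (h : l.length = n) :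
    ∃ y : Fin n → X, l = List.ofFn y := by
  subst h
  exact ⟨l.get, (List.ofFn_get l).symm⟩

theorem listFn_ofFn (f : MultilinearMap K (fun _ : Fin n => L) M) (y : Fin n → G × L) :
    f.listFn (List.ofFn y) = f fun i => (y i).2 := by
  rw [listFn, dif_pos (List.length_ofFn)]
  congr 1
  ext i
  simp

theorem listFn_cons (f : MultilinearMap K (fun _ : Fin (n + 1) => L) M) (p : G × L)
    (l : List (G × L)) : f.listFn (p :: l) = (f.curryLeft p.2).listFn l := by
  by_cases h : l.length = n
  · obtain ⟨y, rfl⟩ := List.exists_eq_ofFn h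
    have hc : p :: List.ofFn y = List.ofFn (Fin.cons p y : Fin (n + 1) → G × L) := by
      simp [List.ofFn_succ]
    rw [hc, listFn_ofFn, listFn_ofFn, curryLeft_apply]
    congr 1
    ext i
    refine Fin.cases ?_ (fun i => ?_) i <;> simp
  · rw [listFn, listFn, dif_neg h, dif_neg (by simpa using h)]

theorem listFn_zero_cons (f : MultilinearMap K (fun _ : Fin 0 => L) M) (p : G × L)
    (l : List (G × L)) : f.listFn (p :: l) = 0 := by
  rw [listFn, dif_neg (by simp)]

theorem isListMultilinear_listFn (f : MultilinearMap K (fun _ : Fin n => L) M) :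
    IsListMultilinear K (f.listFn : List (G × L) → M) where
  add l α x y r := by
    induction l generalizing n with
    | nil =>
      cases n with
      | zero => simp [listFn_zero_cons]
      | succ n =>
        simp only [List.nil_append, listFn_cons]
        by_cases h : r.length = n <;> simp [listFn, h]
    | cons z l ih =>
      cases n with
      | zero => simp [listFn_zero_cons]
      | succ n => simp [listFn_cons, ih]
  smul l α c x r := by
    induction l generalizing n with
    | nil =>
      cases n with
      | zero => simp [listFn_zero_cons]
      | succ n =>
        simp only [List.nil_append, listFn_cons]
        by_cases h : r.length = n <;> simp [listFn, h]
    | cons z l ih =>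
      cases n with
      | zero => simp [listFn_zero_cons]
      | succ n => simp [listFn_cons, ih]

end MultilinearMap

theorem Fin.cons_comp_swap_succ {X : Type*} {n : ℕ} (x : X) (y : Fin n → X) (i j : Fin n) :
    (Fin.cons x y : Fin (n + 1) → X) ∘ Equiv.swap i.succ j.succ =
      Fin.cons x (y ∘ Equiv.swap i j) := by
  ext k
  refine Fin.cases ?_ (fun k => ?_) k
  · simp [Equiv.swap_apply_of_ne_of_ne (Fin.succ_ne_zero i).symm (Fin.succ_ne_zero j).symm]
  · simp only [Function.comp, Fin.cons_succ]
    rcases eq_or_ne k i with rfl | hi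
    · simp
    rcases eq_or_ne k j with rfl | hj
    · simp
    rw [Equiv.swap_apply_of_ne_of_ne hi hj, Equiv.swap_apply_of_ne_of_ne (by simpa) (by simpa)]
    simp

theorem Fin.cons_cons_comp_swap {X : Type*} {n : ℕ} (x y : X) (z : Fin n → X) :
    (Fin.cons x (Fin.cons y z : Fin (n + 1) → X) : Fin (n + 2) → X) ∘ Equiv.swap 0 1 =
      Fin.cons y (Fin.cons x z : Fin (n + 1) → X) := by
  ext k
  refine Fin.cases ?_ (fun k => Fin.cases ?_ (fun k => ?_) k) k
  · simp
  · simp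
  · rw [Function.comp, Equiv.swap_apply_of_ne_of_ne (Fin.succ_ne_zero _)
      (by rw [← Fin.succ_zero_eq_one, Ne, Fin.succ_inj]; exact Fin.succ_ne_zero _)]
    simp

theorem Fin.sum_Iio_succ {X : Type*} [AddCommMonoid X] {n : ℕ} (g : Fin (n + 1) → X) (j : Fin n) :
    ∑ k ∈ Finset.Iio j.succ, g k = g 0 + ∑ k ∈ Finset.Iio j, g k.succ := by
  have h : Finset.Iio j.succ = insert 0 ((Finset.Iio j).map (Fin.succEmb n)) := by
    ext k
    refine Fin.cases ?_ (fun k => ?_) k <;> simp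
  rw [h, Finset.sum_insert (by simp), Finset.sum_map]
  rfl

theorem Fin.sum_Ioo_zero_succ {X : Type*} [AddCommMonoid X] {n : ℕ} (g : Fin (n + 1) → X)
    (j : Fin n) : ∑ k ∈ Finset.Ioo 0 j.succ, g k = ∑ k ∈ Finset.Iio j, g k.succ := by
  have h : Finset.Ioo 0 j.succ = (Finset.Iio j).map (Fin.succEmb n) := by
    ext k
    refine Fin.cases ?_ (fun k => ?_) k <;> simp
  rw [h, Finset.sum_map]
  rfl

theorem Fin.sum_Ioo_succ_succ {X : Type*} [AddCommMonoid X] {n : ℕ} (g : Fin (n + 1) → X)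
    (i j : Fin n) : ∑ k ∈ Finset.Ioo i.succ j.succ, g k = ∑ k ∈ Finset.Ioo i j, g k.succ := by
  have h : Finset.Ioo i.succ j.succ = (Finset.Ioo i j).map (Fin.succEmb n) := by
    ext k
    refine Fin.cases ?_ (fun k => ?_) k <;> simp
  rw [h, Finset.sum_map]
  rfl

namespace ColorModule

variable {G K : Type*} [AddCommGroup G] [Field K] {ε : CommutationFactor G K}
  {L : Type*} [AddCommGroup L] [Module K L] {A : ColorLieAlgebra ε L}
  {M : Type*} [AddCommGroup M] [Module K M] (P : ColorModule A M)

theorem curryLeft_mem_cochains {n : ℕ} {γ α : G} {f : MultilinearMap K (fun _ : Fin (n + 1) => L) M}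
    (hf : f ∈ P.cochains (n + 1) γ) {x : L} (hx : x ∈ A.deg α) :
    f.curryLeft x ∈ P.cochains n (γ + α) := by
  intro β y hy
  have hc : ∀ i, (Fin.cons x y : Fin (n + 1) → L) i ∈ A.deg ((Fin.cons α β : Fin (n + 1) → G) i) :=
    fun i => Fin.cases hx hy i
  obtain ⟨h1, h2⟩ := hf (Fin.cons α β) (Fin.cons x y) hc
  refine ⟨by simpa [Fin.sum_univ_succ, add_assoc] using h1, fun i j hij => ?_⟩
  have h := h2 i.succ j.succ (by simp [hij])
  rw [Fin.cons_comp_swap_succ] at h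
  simpa using h

theorem isListSkew_listFn {n : ℕ} {γ : G} {f : MultilinearMap K (fun _ : Fin n => L) M}
    (hf : f ∈ P.cochains n γ) : IsListSkew A (f.listFn : List (G × L) → M) := by
  intro l p q r h
  induction l generalizing n γ with
  | nil =>
    simp only [List.nil_append] at h ⊢
    obtain ⟨hp, h⟩ := List.forall_mem_cons.mp h
    obtain ⟨hq, hr⟩ := List.forall_mem_cons.mp h
    rcases n with _ | _ | n
    · simp [MultilinearMap.listFn_zero_cons]
    · simp [MultilinearMap.listFn_cons, MultilinearMap.listFn_zero_cons]
    · by_cases hn : r.length = n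
      swap
      · simp [MultilinearMap.listFn, hn]
      subst hn
      obtain ⟨h1, h2⟩ := hf (Fin.cons p.1 (Fin.cons q.1 fun i => (r.get i).1))
        (Fin.cons p.2 (Fin.cons q.2 fun i => (r.get i).2)) (fun i => by
          refine Fin.cases hp (fun i => Fin.cases hq (fun i => ?_) i) i
          exact hr _ (List.get_mem r i))
      have h := h2 0 1 (by simp)
      rw [Fin.cons_cons_comp_swap] at h
      rw [MultilinearMap.listFn_cons, MultilinearMap.listFn_cons, MultilinearMap.listFn_cons,
        MultilinearMap.listFn_cons]
      simpa [MultilinearMap.listFn] using h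
  | cons z l ih =>
    rw [List.cons_append] at h
    obtain ⟨hz, h'⟩ := List.forall_mem_cons.mp h
    cases n with
    | zero => simp [MultilinearMap.listFn_zero_cons]
    | succ n =>
      rw [List.cons_append, List.cons_append, MultilinearMap.listFn_cons,
        MultilinearMap.listFn_cons]
      exact ih (P.curryLeft_mem_cochains hf hz) h'

theorem isListHomogeneous_listFn {n : ℕ} {γ : G} {f : MultilinearMap K (fun _ : Fin n => L) M}
    (hf : f ∈ P.cochains n γ) : P.IsListHomogeneous γ f.listFn := by
  intro l hl
  by_cases h : l.length = n
  · obtain ⟨y, rfl⟩ := List.exists_eq_ofFn h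
    rw [MultilinearMap.listFn_ofFn, List.map_ofFn, List.sum_ofFn]
    exact (hf (fun i => (y i).1) (fun i => (y i).2)
      (fun i => hl _ ((List.mem_ofFn' _ _).mpr ⟨i, rfl⟩))).1
  · rw [MultilinearMap.listFn, dif_neg h]
    exact zero_mem _

/-- The explicit differential can have `[p, y_j]` in front, while the Lie derivative leaves it at
position `j`. Moving it past `y_k` costs `-ε(p + y_j, y_k)`; its part `ε(y_j, y_k)` cancels `ε(y_k,
y_j)` from the explicit sign and leaves `-ε(p, y_k)`. This needs skew-symmetry of `F`. -/
theorem sum_brk_eq_neg_argAction {n : ℕ} {F : List (G × L) → M} (hF : IsListSkew A F)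
    {p : G × L} (hp : p.2 ∈ A.deg p.1) (y : Fin (n + 1) → G × L)
    (hy : ∀ i, (y i).2 ∈ A.deg (y i).1) :
    ∑ j : Fin (n + 1), ((-1) ^ (j.val + 1) * ε (∑ k ∈ Finset.Iio j, (y k).1) (y j).1) •
      F (A.brk p (y j) :: List.ofFn fun k => y (j.succAbove k)) =
    -argAction A p (List.ofFn y) F := by
  induction n generalizing F with
  | zero =>
    have hi : Finset.Iio (0 : Fin 1) = ∅ := by ext; simp
    simp [argAction, ε.zero_left, hi]
  | succ n ih =>
    have hi : Finset.Iio (0 : Fin (n + 2)) = ∅ := by ext; simp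
    rw [Fin.sum_univ_succ, List.ofFn_succ (f := y), argAction, hi]
    simp only [Fin.sum_Iio_succ, Fin.succAbove_zero, Fin.val_zero, zero_add, pow_one,
      Finset.sum_empty, ε.zero_left, mul_one, neg_smul, one_smul, neg_add]
    congr 1
    rw [← smul_neg, ← ih (hF.cons (hy 0)) (fun i => y i.succ) (fun i => hy _), Finset.smul_sum]
    refine Finset.sum_congr rfl fun j _ => ?_
    rw [List.ofFn_succ]
    simp only [Fin.succ_succAbove_zero, Fin.succ_succAbove_succ, Fin.val_succ]
    rw [hF.head_swap (A.brk_mem hp (hy _)) (hy 0) (by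
      intro z hz
      obtain ⟨i, rfl⟩ := (List.mem_ofFn' _ _).mp hz
      exact hy _)]
    have h := ε.mul_swap (y 0).1 (y j.succ).1
    rw [← neg_smul, smul_smul, smul_smul, A.brk_fst, ε.add_left, ε.add_left, pow_succ]
    congr 1
    linear_combination (-1) ^ (j.val + 1) * ε (∑ k ∈ Finset.Iio j, (y k.succ).1) (y j.succ).1 *
      ε p.1 (y 0).1 * h

/-- The terms involving `x_0` are split off. In the remaining ones every index drops by one, which
flips the sign, while `x_0` stays as first argument and adds `α 0` to the degree of the cochain.
This is the recursion defining `listD`, up to the position of the bracket. -/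
theorem dValue_succ {n : ℕ} (γ : G) (f : MultilinearMap K (fun _ : Fin (n + 1) => L) M)
    (α : Fin (n + 2) → G) (x : Fin (n + 2) → L) :
    P.dValue γ f α x = ε γ (α 0) • P.act (x 0) (f fun k => x k.succ) +
      ∑ j : Fin (n + 1), ((-1) ^ (j.val + 1) *
        ε (∑ k ∈ Finset.Iio j, α k.succ) (α j.succ)) •
        f (Fin.cons (A.bracket (x 0) (x j.succ)) fun k => x (j.succAbove k).succ) -
      P.dValue (γ + α 0) (f.curryLeft (x 0)) (fun i => α i.succ) (fun i => x i.succ) := by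
  have hi : Finset.Iio (0 : Fin (n + 2)) = ∅ := by ext; simp
  rw [dValue, dValue, Fin.sum_univ_succ, Fin.sum_univ_succ (n := n + 1), hi, Fin.sum_Ioi_zero]
  simp only [Fin.sum_Iio_succ, Fin.succAbove_zero, Fin.val_zero, pow_zero, one_mul,
    Finset.sum_empty, add_zero, Fin.sum_Ioi_succ, Fin.sum_Ioo_zero_succ, Fin.sum_Ioo_succ_succ,
    Fin.val_succ]
  have e1 : ∀ i : Fin (n + 1), (fun k => x (i.succ.succAbove k)) =
      Fin.cons (x 0) fun k => x (i.succAbove k).succ := by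
    intro i
    ext k
    refine Fin.cases ?_ (fun k => ?_) k <;> simp
  have e2 : ∀ j : Fin (n + 1), (fun k : Fin (n + 1) => if k.castSucc = 0 then
      A.bracket (x 0) (x j.succ) else x (j.succ.succAbove k)) =
      Fin.cons (A.bracket (x 0) (x j.succ)) fun k => x (j.succAbove k).succ := by
    intro j
    ext k
    refine Fin.cases ?_ (fun k => ?_) k <;> simp
  have e3 : ∀ i j : Fin (n + 1), (fun k : Fin (n + 1) => if k.castSucc = i.succ then
      A.bracket (x i.succ) (x j.succ) else x (j.succ.succAbove k)) =
      Fin.cons (x 0) fun k => if k.castSucc = i then A.bracket (x i.succ) (x j.succ) else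
        x (j.succAbove k).succ := by
    intro i j
    ext k
    refine Fin.cases ?_ (fun k => ?_) k
    · simp [(Fin.succ_ne_zero i).symm]
    · simp
  simp only [e1, e2, e3, MultilinearMap.curryLeft_apply, pow_succ, mul_neg, mul_one, neg_mul,
    neg_smul, Finset.sum_neg_distrib, ← add_assoc]
  abel

theorem dValue_eq_listD {n : ℕ} {γ : G} {f : MultilinearMap K (fun _ : Fin n => L) M}
    (hf : f ∈ P.cochains n γ) (α : Fin (n + 1) → G) (x : Fin (n + 1) → L)
    (hx : ∀ i, x i ∈ A.deg (α i)) :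
    P.dValue γ f α x = P.listD (List.ofFn fun i => (α i, x i)) γ f.listFn := by
  induction n generalizing γ with
  | zero =>
    have h : f.listFn ([] : List (G × L)) = f fun k => x k.succ := by
      rw [MultilinearMap.listFn, dif_pos List.length_nil]
      congr 1
      ext k
      exact k.elim0
    have hi' : Finset.Iio (0 : Fin 1) = ∅ := by ext; simp
    simp [dValue, listD, lieDeriv, argAction, h, hi']
  | succ n ih =>
    have hc : (fun l => f.listFn ((α 0, x 0) :: l)) = (f.curryLeft (x 0)).listFn :=
      funext fun l => f.listFn_cons _ _
    rw [List.ofFn_succ, listD, hc, ← ih (P.curryLeft_mem_cochains hf (hx 0)) _ _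
      (fun i => hx i.succ), dValue_succ, lieDeriv, MultilinearMap.listFn_ofFn, sub_eq_add_neg _
      (argAction _ _ _ _), ← sum_brk_eq_neg_argAction (P.isListSkew_listFn hf) (hx 0) _
      (fun i => hx i.succ)]
    congr 2
    refine Finset.sum_congr rfl fun j _ => ?_
    rw [MultilinearMap.listFn_cons, MultilinearMap.listFn_ofFn, MultilinearMap.curryLeft_apply]
    rfl

end ColorModule

/-- A basis of a graded vector space that consists of homogeneous vectors. -/
structure HomogeneousBasis {G K V : Type*} [Field K] [AddCommGroup V] [Module K V]
    (deg : G → Submodule K V) where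
  dim : ℕ
  basis : Module.Basis (Fin dim) K V
  label : Fin dim → G
  mem : ∀ i, basis i ∈ deg (label i)
  repr_eq_zero : ∀ α, ∀ x ∈ deg α, ∀ i, label i ≠ α → basis.repr x i = 0

/-! ### Homogeneous bases and multilinear maps. -/

namespace HomogeneousBasis

section

variable {G K V : Type*} [Field K] [AddCommGroup V] [Module K V] {deg : G → Submodule K V}

theorem nonempty_of_iSupIndep [FiniteDimensional K V] (h : iSupIndep deg) (h' : ⨆ α, deg α = ⊤) :
    Nonempty (HomogeneousBasis deg) := by
  classical
  have hi := DirectSum.isInternal_submodule_of_iSupIndep_of_iSup_eq_top h h'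
  let b := hi.collectedBasis fun α => Module.finBasis K (deg α)
  have := Module.Finite.finite_basis b
  let φ := Finite.equivFin (Σ α, Fin (Module.finrank K (deg α)))
  refine ⟨⟨_, b.reindex φ, fun i => (φ.symm i).1, fun i => ?_, fun α x hx i hiα => ?_⟩⟩
  · rw [Module.Basis.reindex_apply]
    exact hi.collectedBasis_mem _ _
  · rw [Module.Basis.repr_reindex_apply]
    exact hi.collectedBasis_repr_of_mem_ne _ hiα.symm hx

variable (e : HomogeneousBasis deg)

theorem sum_label_eq {α : G} [DecidableEq G] {x : V} (hx : x ∈ deg α) :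
    ∑ i with e.label i = α, e.basis.repr x i • e.basis i = x := by
  conv_rhs => rw [← e.basis.sum_repr x]
  refine Finset.sum_subset (Finset.subset_univ _) fun i _ hi => ?_
  rw [e.repr_eq_zero α x hx i (by simpa using hi), zero_smul]

theorem deg_eq_span (α : G) :
    deg α = Submodule.span K (Set.range fun i : {i // e.label i = α} => e.basis i) := by
  classical
  apply le_antisymm
  · intro x hx
    rw [← e.sum_label_eq hx]
    refine Submodule.sum_mem _ fun i hi => Submodule.smul_mem _ _ (Submodule.subset_span ?_)
    exact ⟨⟨i, by simpa using hi⟩, rfl⟩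
  · rw [Submodule.span_le]
    rintro _ ⟨⟨i, rfl⟩, rfl⟩
    exact e.mem i

theorem finrank_deg [DecidableEq G] (α : G) :
    Module.finrank K (deg α) = (Finset.univ.filter fun i => e.label i = α).card := by
  have h : LinearIndependent K fun i : {i // e.label i = α} => e.basis i :=
    e.basis.linearIndependent.comp _ Subtype.val_injective
  rw [e.deg_eq_span, finrank_span_eq_card h, Fintype.card_subtype]

theorem finrank_iSup_deg (s : Set G) [DecidablePred (· ∈ s)] :
    Module.finrank K ↥(⨆ α ∈ s, deg α) =
      (Finset.univ.filter fun i => e.label i ∈ s).card := by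
  have h : LinearIndependent K fun i : {i // e.label i ∈ s} => e.basis i :=
    e.basis.linearIndependent.comp _ Subtype.val_injective
  have hs : ⨆ α ∈ s, deg α =
      Submodule.span K (Set.range fun i : {i // e.label i ∈ s} => e.basis i) := by
    apply le_antisymm
    · refine iSup₂_le fun α hα => ?_
      rw [e.deg_eq_span, Submodule.span_le]
      rintro _ ⟨⟨i, rfl⟩, rfl⟩
      exact Submodule.subset_span ⟨⟨i, hα⟩, rfl⟩
    · rw [Submodule.span_le]
      rintro _ ⟨⟨i, hi⟩, rfl⟩
      exact Submodule.mem_iSup_of_mem _ (Submodule.mem_iSup_of_mem hi (e.mem i))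
  rw [hs, finrank_span_eq_card h, Fintype.card_subtype]

variable {N : Type*} [AddCommGroup N] [Module K N] {n : ℕ}

theorem multilinear_ext {f g : MultilinearMap K (fun _ : Fin n => V) N} {α : Fin n → G}
    (h : ∀ s : Fin n → Fin e.dim, (∀ i, e.label (s i) = α i) →
      f (e.basis ∘ s) = g (e.basis ∘ s))
    {x : Fin n → V} (hx : ∀ i, x i ∈ deg (α i)) : f x = g x := by
  classical
  -- `q β` is the projection onto `deg β`. Precomposing with these projections kills all basis
  -- tuples with other labels, so equality can be tested on all basis tuples and fixes `x` at the
  -- end.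
  let q (β : G) : V →ₗ[K] V := e.basis.constr K fun i => if e.label i = β then e.basis i else 0
  have hq : ∀ β, ∀ y ∈ deg β, q β y = y := by
    intro β y hy
    conv_lhs => rw [← e.sum_label_eq hy]
    conv_rhs => rw [← e.sum_label_eq hy]
    rw [map_sum]
    refine Finset.sum_congr rfl fun i hi => ?_
    have hi' : e.label i = β := by simpa using hi
    rw [map_smul, Module.Basis.constr_basis, if_pos hi']
  have key : f.compLinearMap (fun i => q (α i)) = g.compLinearMap fun i => q (α i) := by
    refine Module.Basis.ext_multilinear (fun _ => e.basis) fun s => ?_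
    simp only [MultilinearMap.compLinearMap_apply, q, Module.Basis.constr_basis]
    by_cases hs : ∀ i, e.label (s i) = α i
    · simpa [hs, Function.comp_def] using h s hs
    · obtain ⟨i, hi⟩ := not_forall.mp hs
      rw [f.map_coord_zero i (if_neg hi), g.map_coord_zero i (if_neg hi)]
  have := congrArg (fun F => F x) key
  simpa [hq _ _ (hx _)] using this

theorem multilinear_mem {f : MultilinearMap K (fun _ : Fin n => V) N} {α : Fin n → G}
    {W : Submodule K N}
    (h : ∀ s : Fin n → Fin e.dim, (∀ i, e.label (s i) = α i) → f (e.basis ∘ s) ∈ W)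
    {x : Fin n → V} (hx : ∀ i, x i ∈ deg (α i)) : f x ∈ W := by
  have := e.multilinear_ext (f := W.mkQ.compMultilinearMap f) (g := 0) (α := α)
    (fun s hs => by simpa using h s hs) hx
  simpa using this

/-- The multilinear map with prescribed values on basis vectors. -/
noncomputable def multiConstr :
    ((Fin n → Fin e.dim) → N) →ₗ[K] MultilinearMap K (fun _ : Fin n => V) N where
  toFun v := ∑ s, ((MultilinearMap.mkPiAlgebra K (Fin n) K).compLinearMap
    fun i => e.basis.coord (s i)).smulRight (v s)
  map_add' v w := by
    ext x
    simp [Finset.sum_add_distrib]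
  map_smul' c v := by
    ext x
    simp [Finset.smul_sum, smul_comm c]

theorem multiConstr_basis (v : (Fin n → Fin e.dim) → N) (s : Fin n → Fin e.dim) :
    e.multiConstr v (e.basis ∘ s) = v s := by
  classical
  simp only [multiConstr, LinearMap.coe_mk, AddHom.coe_mk, sum_apply,
    MultilinearMap.smulRight_apply, MultilinearMap.compLinearMap_apply,
    MultilinearMap.mkPiAlgebra_apply, Module.Basis.coord_apply, Function.comp_apply,
    Module.Basis.repr_self]
  rw [Finset.sum_eq_single s]
  · simp
  · intro t _ hts
    obtain ⟨i, hi⟩ := Function.ne_iff.mp hts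
    rw [Finset.prod_eq_zero (Finset.mem_univ i), zero_smul]
    rw [Finsupp.single_eq_of_ne hi]
  · simp

end

end HomogeneousBasis

theorem List.exists_ofFn_split {X : Type*} {n : ℕ} (y : Fin n → X) (i : Fin n) :
    ∃ l r, ∀ y' : Fin n → X, (∀ k, k ≠ i → y' k = y k) → List.ofFn y' = l ++ y' i :: r := by
  induction n with
  | zero => exact i.elim0
  | succ n ih =>
    refine Fin.cases ?_ (fun i => ?_) i
    · refine ⟨[], List.ofFn fun k => y k.succ, fun y' h => ?_⟩
      rw [List.ofFn_succ, List.nil_append]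
      congr 2
      ext k
      exact h _ (Fin.succ_ne_zero k)
    · obtain ⟨l, r, h⟩ := ih (fun k => y k.succ) i
      refine ⟨y 0 :: l, r, fun y' hy' => ?_⟩
      rw [List.ofFn_succ, h _ fun k hk => hy' _ (by simpa using hk),
        hy' 0 (Fin.succ_ne_zero i).symm, List.cons_append]

theorem List.exists_ofFn_update {G X : Type*} {n : ℕ} (α : Fin n → G) (x : Fin n → X)
    [DecidableEq (Fin n)] (i : Fin n) :
    ∃ l r, ∀ u, List.ofFn (fun k => (α k, Function.update x i u k)) = l ++ (α i, u) :: r := by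
  obtain ⟨l, r, h⟩ := List.exists_ofFn_split (fun k => (α k, x k)) i
  refine ⟨l, r, fun u => ?_⟩
  rw [h _ fun k hk => by rw [Function.update_of_ne hk], Function.update_self]

theorem List.exists_ofFn_swap {X : Type*} {n : ℕ} (y : Fin n → X) {i j : Fin n}
    (hij : j.val = i.val + 1) :
    ∃ l r, List.ofFn y = l ++ y i :: y j :: r ∧
      List.ofFn (y ∘ Equiv.swap i j) = l ++ y j :: y i :: r := by
  induction n with
  | zero => exact i.elim0
  | succ n ih =>
    obtain ⟨y0, y, rfl⟩ : ∃ y0 y', y = Fin.cons y0 y' := ⟨_, _, (Fin.cons_self_tail y).symm⟩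
    obtain ⟨j, rfl⟩ : ∃ j', j = Fin.succ j' := Fin.exists_succ_eq_of_ne_zero (by
      rintro rfl
      simp at hij) |>.imp fun _ h => h.symm
    refine Fin.cases (fun hij => ?_) (fun i hij => ?_) i hij
    · cases n with
      | zero => exact j.elim0
      | succ n =>
        obtain rfl : j = 0 := by
          ext
          simpa using hij
        obtain ⟨y1, y, rfl⟩ : ∃ y0 y', y = Fin.cons y0 y' := ⟨_, _, (Fin.cons_self_tail y).symm⟩
        refine ⟨[], List.ofFn y, by simp [List.ofFn_succ], ?_⟩
        rw [Fin.succ_zero_eq_one, Fin.cons_cons_comp_swap]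
        simp [List.ofFn_succ]
    · obtain ⟨l, r, h1, h2⟩ := ih y (i := i) (j := j) (by simpa using hij)
      refine ⟨y0 :: l, r, by simp [List.ofFn_succ, h1], ?_⟩
      rw [Fin.cons_comp_swap_succ]
      simpa [List.ofFn_succ, Function.comp_def] using h2

/-- The multilinear map given by a multilinear function of lists and fixed labels. -/
def IsListMultilinear.toMultilinearMap {G K L M : Type*} [Field K] [AddCommGroup L] [Module K L]
    [AddCommGroup M] [Module K M] {F : List (G × L) → M} (hF : IsListMultilinear K F) {n : ℕ}
    (α : Fin n → G) : MultilinearMap K (fun _ : Fin n => L) M where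
  toFun x := F (List.ofFn fun i => (α i, x i))
  map_update_add' x i u v := by
    obtain ⟨l, r, h⟩ := List.exists_ofFn_update α x i
    rw [h, h, h, hF.add]
  map_update_smul' x i c u := by
    obtain ⟨l, r, h⟩ := List.exists_ofFn_update α x i
    rw [h, h, hF.smul]

/-! ### The complex of cochains and its dimension count. -/

namespace ColorModule

variable {G K : Type*} [AddCommGroup G] [Field K] {ε : CommutationFactor G K}
  {L : Type*} [AddCommGroup L] [Module K L] {A : ColorLieAlgebra ε L}
  {M : Type*} [AddCommGroup M] [Module K M] (P : ColorModule A M)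
  (e : HomogeneousBasis A.deg)

/-- The Chevalley-Eilenberg differential as a linear map. -/
noncomputable def differential (n : ℕ) (γ : G) :
    MultilinearMap K (fun _ : Fin n => L) M →ₗ[K] MultilinearMap K (fun _ : Fin (n + 1) => L) M :=
  e.multiConstr ∘ₗ LinearMap.pi fun s =>
    { toFun := fun f => P.dValue γ f (e.label ∘ s) (e.basis ∘ s)
      map_add' := fun f g => P.dValue_add γ f g _ _
      map_smul' := fun c f => P.dValue_smul γ c f _ _ }

theorem differential_basis {n : ℕ} {γ : G} (f : MultilinearMap K (fun _ : Fin n => L) M)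
    (s : Fin (n + 1) → Fin e.dim) :
    P.differential e n γ f (e.basis ∘ s) = P.dValue γ f (e.label ∘ s) (e.basis ∘ s) :=
  e.multiConstr_basis _ _

/-- For fixed labels both sides are multilinear in `x`, so basis vectors suffice. This is also why
the formula for `d` on homogeneous tuples defines a multilinear map. -/
theorem differential_eq_listD {n : ℕ} {γ : G} {f : MultilinearMap K (fun _ : Fin n => L) M}
    (hf : f ∈ P.cochains n γ) {α : Fin (n + 1) → G} {x : Fin (n + 1) → L}
    (hx : ∀ i, x i ∈ A.deg (α i)) :
    P.differential e n γ f x = P.listD (List.ofFn fun i => (α i, x i)) γ f.listFn := by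
  refine e.multilinear_ext (g := (P.isListMultilinear_listD
    f.isListMultilinear_listFn γ).toMultilinearMap α) (fun s hs => ?_) hx
  obtain rfl : e.label ∘ s = α := funext hs
  rw [differential_basis, P.dValue_eq_listD hf (e.label ∘ s) (e.basis ∘ s) fun i => e.mem (s i)]
  rfl

theorem isDifferential_differential {n : ℕ} {γ : G}
    {f : MultilinearMap K (fun _ : Fin n => L) M} (hf : f ∈ P.cochains n γ) :
    P.IsDifferential γ f (P.differential e n γ f) := by
  intro α x hx
  rw [P.differential_eq_listD e hf hx, P.dValue_eq_listD hf α x hx]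

theorem isDifferential_iff {n : ℕ} {γ : G} {f : MultilinearMap K (fun _ : Fin n => L) M}
    (hf : f ∈ P.cochains n γ) {g : MultilinearMap K (fun _ : Fin (n + 1) => L) M} :
    P.IsDifferential γ f g ↔ P.differential e n γ f = g := by
  refine ⟨fun h => ?_, fun h => h ▸ P.isDifferential_differential e hf⟩
  refine Module.Basis.ext_multilinear (fun _ => e.basis) fun s => ?_
  rw [h _ _ fun i => e.mem (s i)]
  exact P.differential_basis e f s

theorem differential_mem_cochains {n : ℕ} {γ : G}
    {f : MultilinearMap K (fun _ : Fin n => L) M} (hf : f ∈ P.cochains n γ) :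
    P.differential e n γ f ∈ P.cochains (n + 1) γ := by
  intro α x hx
  have hmem : ∀ z ∈ List.ofFn fun i => (α i, x i), z.2 ∈ A.deg z.1 := by
    intro z hz
    obtain ⟨i, rfl⟩ := (List.mem_ofFn' _ _).mp hz
    exact hx i
  refine ⟨?_, fun i j hij => ?_⟩
  · rw [P.differential_eq_listD e hf hx]
    have := (P.isListHomogeneous_listFn hf).listD _ hmem
    rwa [List.map_ofFn, List.sum_ofFn] at this
  · have hx' : ∀ k, (x ∘ Equiv.swap i j) k ∈ A.deg ((α ∘ Equiv.swap i j) k) := fun k => hx _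
    rw [P.differential_eq_listD e hf hx, P.differential_eq_listD e hf hx']
    obtain ⟨l, r, h1, h2⟩ := List.exists_ofFn_swap (fun i => (α i, x i)) hij
    have h2' : (List.ofFn fun k => ((α ∘ Equiv.swap i j) k, (x ∘ Equiv.swap i j) k)) =
      l ++ (α j, x j) :: (α i, x i) :: r := h2
    rw [h1] at hmem
    rw [h1, h2']
    exact P.isListSkew_listD (P.isListSkew_listFn hf) f.isListMultilinear_listFn γ _ _ _ _ hmem

/-- The list function of `df` agrees with `listD` on homogeneous lists of the right length, which is
all that the second differential sees. -/
theorem differential_differential {n : ℕ} {γ : G}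
    {f : MultilinearMap K (fun _ : Fin n => L) M} (hf : f ∈ P.cochains n γ) :
    P.differential e (n + 1) γ (P.differential e n γ f) = 0 := by
  rw [← P.isDifferential_iff e (P.differential_mem_cochains e hf)]
  intro α x hx
  have hmem : ∀ z ∈ List.ofFn fun i => (α i, x i), z.2 ∈ A.deg z.1 := by
    intro z hz
    obtain ⟨i, rfl⟩ := (List.mem_ofFn' _ _).mp hz
    exact hx i
  rw [P.dValue_eq_listD (P.differential_mem_cochains e hf) _ _ hx,
    P.listD_congr γ (F' := fun l => P.listD l γ f.listFn) hmem,
    P.listD_listD f.isListMultilinear_listFn γ hmem]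
  · rfl
  · intro l hl hl'
    obtain ⟨y, rfl⟩ := List.exists_eq_ofFn (n := n + 1) (by simpa using hl)
    rw [MultilinearMap.listFn_ofFn]
    exact P.differential_eq_listD e hf fun i => hl' _ ((List.mem_ofFn' _ _).mpr ⟨i, rfl⟩)

theorem cocycles_eq (n : ℕ) (γ : G) :
    P.cocycles n γ = P.cochains n γ ⊓ LinearMap.ker (P.differential e n γ) := by
  ext f
  exact and_congr_right fun hf => P.isDifferential_iff e hf

theorem coboundaries_succ_eq (n : ℕ) (γ : G) :
    P.coboundaries (n + 1) γ = (P.cochains n γ).map (P.differential e n γ) := by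
  ext g
  exact exists_congr fun f => and_congr_right fun hf => P.isDifferential_iff e hf

theorem coboundaries_le_cocycles (e : HomogeneousBasis A.deg) (n : ℕ) (γ : G) :
    P.coboundaries n γ ≤ P.cocycles n γ := by
  cases n with
  | zero => exact bot_le
  | succ n =>
    rw [P.coboundaries_succ_eq e, P.cocycles_eq e]
    rintro _ ⟨f, hf, rfl⟩
    exact ⟨P.differential_mem_cochains e hf, P.differential_differential e hf⟩

/-- Rank-nullity for `d` on `C^n_γ`, whose image is `B^(n+1)_γ`, combined with the dimension of the
quotient `Z^n_γ / B^n_γ`. -/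
theorem finrank_cochains [FiniteDimensional K L] [FiniteDimensional K M]
    (e : HomogeneousBasis A.deg) (n : ℕ) (γ : G) :
    Module.finrank K (P.cochains n γ) = P.dimH n γ + P.dimB n γ + P.dimB (n + 1) γ := by
  have h1 := LinearMap.finrank_range_add_finrank_ker
    ((P.differential e n γ).domRestrict (P.cochains n γ))
  rw [LinearMap.range_domRestrict, ← P.coboundaries_succ_eq e] at h1
  have h2 : LinearMap.ker ((P.differential e n γ).domRestrict (P.cochains n γ)) =
      (P.cocycles n γ).submoduleOf (P.cochains n γ) := by
    ext f
    rw [Submodule.submoduleOf, Submodule.mem_comap, P.cocycles_eq e]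
    simp
  have h3 : P.cocycles n γ ≤ P.cochains n γ := by
    rw [P.cocycles_eq e]
    exact inf_le_left
  rw [h2, (Submodule.submoduleOfEquivOfLe h3).finrank_eq] at h1
  have h4 := Submodule.finrank_quotient_add_finrank
    ((P.coboundaries n γ).submoduleOf (P.cocycles n γ))
  rw [(Submodule.submoduleOfEquivOfLe (P.coboundaries_le_cocycles e n γ)).finrank_eq] at h4
  rw [← h1, ← h4]
  simp only [dimB, dimH]
  ring

end ColorModule

/-! ### Cochains as families indexed by sorted monomials. -/

theorem List.Perm.eq_of_swap_invariant {X Y : Type*} {g : List X → Y}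
    (hg : ∀ l x y r, g (l ++ x :: y :: r) = g (l ++ y :: x :: r)) {l₁ l₂ : List X}
    (h : l₁.Perm l₂) : g l₁ = g l₂ := by
  -- A prefix is carried along so that a common head can be absorbed into it.
  suffices ∀ l, g (l ++ l₁) = g (l ++ l₂) from this []
  induction h with
  | nil => exact fun _ => rfl
  | cons x _ ih => exact fun l => by simpa using ih (l ++ [x])
  | swap x y r => exact fun l => hg l y x r
  | trans _ _ ih₁ ih₂ => exact fun l => (ih₁ l).trans (ih₂ l)

namespace CommutationFactor

variable {G K : Type*} [AddCommGroup G] [Field K] (ε : CommutationFactor G K)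

theorem self_eq_one_or (α : G) : ε α α = 1 ∨ ε α α = -1 :=
  mul_self_eq_one_iff.mp (ε.mul_swap α α)

theorem self_eq_neg_one {α : G} (h : α ∉ ε.even) : ε α α = -1 :=
  (ε.self_eq_one_or α).resolve_left h

variable {ι : Type*} [LinearOrder ι] (a : ι → G)

/-- The factor that an `ε`-skew-symmetric map picks up when the entries of a list, of degrees
given by `a`, are sorted. -/
def sortSign : List ι → K
  | [] => 1
  | x :: xs => (xs.map fun y => if y < x then -ε (a x) (a y) else 1).prod * sortSign xs

theorem sortSign_ne_zero (l : List ι) : ε.sortSign a l ≠ 0 := by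
  induction l with
  | nil => exact one_ne_zero
  | cons x xs ih =>
    refine mul_ne_zero (List.prod_ne_zero ?_) ih
    simp only [List.mem_map, not_exists, not_and]
    intro y _
    split_ifs
    · exact neg_ne_zero.mpr (ε.ne_zero _ _)
    · exact one_ne_zero

/-- Exactly one of the orders `x y` and `y x` is an inversion, and the factors `-ε(x, y)` and `-ε(y,
x)` are mutually inverse. An entry further left contributes a product over its tail, which ignores
the order. For `x = y` the formula would require `ε(x, x) = -1`, hence the hypothesis. -/
theorem sortSign_swap (l : List ι) {x y : ι} (hxy : x ≠ y) (r : List ι) :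
    ε.sortSign a (l ++ x :: y :: r) = -ε (a x) (a y) * ε.sortSign a (l ++ y :: x :: r) := by
  induction l with
  | nil =>
    have h := ε.mul_swap (a x) (a y)
    simp only [List.nil_append, sortSign, List.map_cons, List.prod_cons]
    rcases lt_or_gt_of_ne hxy with hlt | hlt
    · rw [if_neg hlt.asymm, if_pos hlt]
      set X := (r.map fun z => if z < x then -ε (a x) (a z) else 1).prod
      set Y := (r.map fun z => if z < y then -ε (a y) (a z) else 1).prod
      linear_combination -(X * Y * ε.sortSign a r) * h
    · rw [if_pos hlt, if_neg hlt.asymm]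
      ring
  | cons z l ih =>
    have hp : (l ++ x :: y :: r).Perm (l ++ y :: x :: r) :=
      (List.Perm.swap y x r).append_left l
    rw [List.cons_append, List.cons_append, sortSign, sortSign, ih, (hp.map _).prod_eq]
    ring

end CommutationFactor

namespace ColorModule

variable {G K : Type*} [AddCommGroup G] [Field K] {ε : CommutationFactor G K}
  {L : Type*} [AddCommGroup L] [Module K L] {A : ColorLieAlgebra ε L}
  {M : Type*} [AddCommGroup M] [Module K M] (P : ColorModule A M)
  (e : HomogeneousBasis A.deg)

open Classical in
/-- The exponents of the monomials of degree `n` in the basis vectors that are nonzero in the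
`ε`-exterior algebra: a basis vector of even degree occurs at most once. -/
noncomputable def exponents (e : HomogeneousBasis A.deg) (n : ℕ) : Finset (Fin e.dim →₀ ℕ) :=
  (Finset.finsuppAntidiag Finset.univ n).filter fun l => ∀ k, e.label k ∈ ε.even → l k ≤ 1

theorem mem_exponents {n : ℕ} {l : Fin e.dim →₀ ℕ} :
    l ∈ exponents e n ↔ (∑ k, l k = n) ∧ ∀ k, e.label k ∈ ε.even → l k ≤ 1 := by
  simp [exponents, Finset.mem_finsuppAntidiag]

/-- The number of occurrences of every index in a list. -/
noncomputable def occurrences {d : ℕ} (l : List (Fin d)) : Fin d →₀ ℕ :=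
  Multiset.toFinsupp (l : Multiset (Fin d))

theorem occurrences_apply {d : ℕ} (l : List (Fin d)) (k : Fin d) :
    occurrences l k = l.count k := by
  simp [occurrences]

theorem occurrences_eq_iff {d : ℕ} {l₁ l₂ : List (Fin d)} :
    occurrences l₁ = occurrences l₂ ↔ l₁.Perm l₂ := by
  rw [occurrences, occurrences, EmbeddingLike.apply_eq_iff_eq, Multiset.coe_eq_coe]

theorem sum_occurrences_smul {X : Type*} [AddCommMonoid X] {d : ℕ} (a : Fin d → X)
    (l : List (Fin d)) : ∑ k, occurrences l k • a k = (l.map a).sum := by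
  simp only [occurrences_apply]
  induction l with
  | nil => simp
  | cons x l ih =>
    simp [List.count_cons, add_smul, Finset.sum_add_distrib, ih, add_comm]

theorem sum_occurrences {d : ℕ} (l : List (Fin d)) : ∑ k, occurrences l k = l.length := by
  simpa using sum_occurrences_smul (fun _ => (1 : ℕ)) l

theorem exists_occurrences_eq {d n : ℕ} {c : Fin d →₀ ℕ} (hc : ∑ k, c k = n) :
    ∃ s : Fin n → Fin d, occurrences (List.ofFn s) = c := by
  have h : occurrences (Finsupp.toMultiset c).toList = c := by
    simp [occurrences]
  obtain ⟨s, hs⟩ := List.exists_eq_ofFn (n := n) (by rw [← sum_occurrences, h, hc])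
  exact ⟨s, hs ▸ h⟩

open Classical in
/-- The cochain with prescribed values, up to sign, on sorted tuples of basis vectors. -/
noncomputable def ofExponents (n : ℕ) (γ : G) :
    (∀ c : exponents e n, P.deg (γ + ∑ k, c.1 k • e.label k)) →ₗ[K]
      MultilinearMap K (fun _ : Fin n => L) M :=
  e.multiConstr ∘ₗ
    { toFun := fun v s =>
        if h : occurrences (List.ofFn s) ∈ exponents e n then
          ε.sortSign e.label (List.ofFn s) • (v ⟨_, h⟩ : M)
        else 0
      map_add' := fun v w => by
        funext s
        simp only [Pi.add_apply, Submodule.coe_add, smul_add]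
        split_ifs <;> simp
      map_smul' := fun c v => by
        funext s
        simp only [Pi.smul_apply, Submodule.coe_smul, RingHom.id_apply]
        split_ifs <;> simp [smul_comm c] }

theorem ofExponents_basis_of_mem {n : ℕ} {γ : G}
    (v : ∀ c : exponents e n, P.deg (γ + ∑ k, c.1 k • e.label k)) {s : Fin n → Fin e.dim}
    {c : Fin e.dim →₀ ℕ} (hc : c ∈ exponents e n) (hs : occurrences (List.ofFn s) = c) :
    P.ofExponents e n γ v (e.basis ∘ s) =
      ε.sortSign e.label (List.ofFn s) • (v ⟨c, hc⟩ : M) := by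
  subst hs
  rw [ofExponents, LinearMap.comp_apply, e.multiConstr_basis]
  exact dif_pos hc

theorem ofExponents_basis_of_notMem {n : ℕ} {γ : G}
    (v : ∀ c : exponents e n, P.deg (γ + ∑ k, c.1 k • e.label k)) {s : Fin n → Fin e.dim}
    (hs : occurrences (List.ofFn s) ∉ exponents e n) :
    P.ofExponents e n γ v (e.basis ∘ s) = 0 := by
  rw [ofExponents, LinearMap.comp_apply, e.multiConstr_basis]
  exact dif_neg hs

theorem ofExponents_mem_cochains {n : ℕ} {γ : G}
    (v : ∀ c : exponents e n, P.deg (γ + ∑ k, c.1 k • e.label k)) :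
    P.ofExponents e n γ v ∈ P.cochains n γ := by
  intro α x hx
  refine ⟨e.multilinear_mem (fun s hs => ?_) hx, fun i j hij => ?_⟩
  · by_cases h : occurrences (List.ofFn s) ∈ exponents e n
    · rw [P.ofExponents_basis_of_mem e v h rfl]
      refine Submodule.smul_mem _ _ ?_
      have := (v ⟨_, h⟩).2
      simpa only [sum_occurrences_smul, List.map_ofFn, List.sum_ofFn, Function.comp_apply, hs]
        using this
    · rw [P.ofExponents_basis_of_notMem e v h]
      exact zero_mem _
  · refine e.multilinear_ext (g := -(ε (α i) (α j) •
      (P.ofExponents e n γ v).domDomCongr (Equiv.swap i j))) (fun s hs => ?_) hx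
    change _ = -(ε (α i) (α j) • P.ofExponents e n γ v (e.basis ∘ (s ∘ Equiv.swap i j)))
    obtain ⟨l, r, h1, h2⟩ := List.exists_ofFn_swap s hij
    have hp : (List.ofFn (s ∘ Equiv.swap i j)).Perm (List.ofFn s) := by
      rw [h1, h2]
      exact (List.Perm.swap _ _ r).append_left l
    by_cases h : occurrences (List.ofFn s) ∈ exponents e n
    · rw [P.ofExponents_basis_of_mem e v h rfl,
        P.ofExponents_basis_of_mem e v h (occurrences_eq_iff.mpr hp), smul_smul, ← neg_smul]
      congr 1
      rw [h1, h2, ← hs i, ← hs j]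
      -- A swap of equal indices leaves the sorting sign alone, so skew-symmetry needs `-ε(α, α) =
      -- 1`. An index repeated in an allowed exponent is indeed odd.
      by_cases hsij : s i = s j
      · have hodd : e.label (s j) ∉ ε.even := fun hev => by
          have := ((mem_exponents e).mp h).2 _ hev
          rw [occurrences_apply, h1, hsij] at this
          simp [List.count_append] at this
          omega
        rw [hsij, ε.self_eq_neg_one hodd]
        ring
      · rw [ε.sortSign_swap _ _ hsij]
        ring
    · rw [P.ofExponents_basis_of_notMem e v h, P.ofExponents_basis_of_notMem e v
        (by rwa [occurrences_eq_iff.mpr hp]), smul_zero, neg_zero]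

/-- Dividing a skew-symmetric function by the sorting sign makes it symmetric, so that it depends
only on how often each basis vector occurs. Exponents that repeat an even vector carry the value
zero in characteristic `≠ 2`. -/
theorem cochains_eq_range (hK : (2 : K) ≠ 0) (n : ℕ) (γ : G) :
    LinearMap.range (P.ofExponents e n γ) = P.cochains n γ := by
  apply le_antisymm
  · rintro _ ⟨v, rfl⟩
    exact P.ofExponents_mem_cochains e v
  intro f hf
  let F (l : List (Fin e.dim)) : M := f.listFn (l.map fun k => (e.label k, e.basis k))
  have hFs (s : Fin n → Fin e.dim) : F (List.ofFn s) = f (e.basis ∘ s) := by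
    simp only [F, List.map_ofFn, MultilinearMap.listFn_ofFn]
    rfl
  have hF (l : List (Fin e.dim)) (x y : Fin e.dim) (r : List (Fin e.dim)) :
      F (l ++ x :: y :: r) = -(ε (e.label x) (e.label y) • F (l ++ y :: x :: r)) := by
    simp only [F, List.map_append, List.map_cons]
    refine P.isListSkew_listFn hf _ _ _ _ fun z hz => ?_
    rw [← List.map_cons (f := fun k => (e.label k, e.basis k)),
      ← List.map_cons (f := fun k => (e.label k, e.basis k)), ← List.map_append] at hz
    obtain ⟨k, -, rfl⟩ := List.mem_map.mp hz
    exact e.mem k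
  let g (l : List (Fin e.dim)) : M := (ε.sortSign e.label l)⁻¹ • F l
  have hg : ∀ l x y r, g (l ++ x :: y :: r) = g (l ++ y :: x :: r) := by
    intro l x y r
    rcases eq_or_ne x y with rfl | hxy
    · rfl
    · simp only [g]
      rw [hF, ε.sortSign_swap _ _ hxy, ← neg_smul, smul_smul]
      congr 1
      have := ε.ne_zero (e.label x) (e.label y)
      have := ε.sortSign_ne_zero e.label (l ++ y :: x :: r)
      field_simp
  -- Any arrangement of the exponent serves, as `g` is symmetric.
  choose rep hrep using fun c : exponents e n => exists_occurrences_eq ((mem_exponents e).mp c.2).1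
  refine ⟨fun c => ⟨g (List.ofFn (rep c)), ?_⟩, ?_⟩
  · refine Submodule.smul_mem _ _ ?_
    rw [hFs, ← hrep c, sum_occurrences_smul, List.map_ofFn, List.sum_ofFn]
    exact (hf (e.label ∘ rep c) _ fun i => e.mem _).1
  · refine Module.Basis.ext_multilinear (fun _ => e.basis) fun s => ?_
    change P.ofExponents e n γ _ (e.basis ∘ s) = f (e.basis ∘ s)
    by_cases h : occurrences (List.ofFn s) ∈ exponents e n
    · rw [P.ofExponents_basis_of_mem e _ h rfl]
      simp only
      rw [(occurrences_eq_iff.mp (hrep ⟨_, h⟩)).eq_of_swap_invariant hg, ← hFs,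
        smul_inv_smul₀ (ε.sortSign_ne_zero _ _)]
    · rw [P.ofExponents_basis_of_notMem e _ h, ← hFs]
      have hlen : ∑ k, occurrences (List.ofFn s) k = n := by simp [sum_occurrences]
      have h' : ∃ k, e.label k ∈ ε.even ∧ 2 ≤ (List.ofFn s).count k := by
        by_contra! hcon
        refine h ((mem_exponents e).mpr ⟨hlen, fun k hk => ?_⟩)
        rw [occurrences_apply]
        exact Nat.le_of_lt_succ (hcon k hk)
      obtain ⟨k, hk, hk2⟩ := h'
      obtain ⟨r, hr⟩ : ∃ r, (List.ofFn s).Perm (k :: k :: r) := by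
        have h1 := List.perm_cons_erase (List.count_pos_iff.mp (by omega : 0 < (List.ofFn s).count k))
        have h2 := List.perm_cons_erase (List.count_pos_iff.mp
          (by rw [List.count_erase_self]; omega : 0 < ((List.ofFn s).erase k).count k))
        exact ⟨_, h1.trans (h2.cons k)⟩
      -- Swapping the two equal even entries gives `F = -F`; this is where characteristic `≠ 2`
      -- enters.
      have hz : F (k :: k :: r) = 0 := by
        have h1 := hF [] k k r
        rw [List.nil_append, show ε (e.label k) (e.label k) = 1 from hk, one_smul] at h1
        have h2 : (2 : K) • F (k :: k :: r) = 0 := by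
          rw [two_smul]
          nth_rewrite 1 [h1]
          exact neg_add_cancel _
        exact (smul_eq_zero.mp h2).resolve_left hK
      have h3 := hr.eq_of_swap_invariant hg
      simp only [g, hz, smul_zero] at h3
      exact ((smul_eq_zero.mp h3).resolve_left (inv_ne_zero (ε.sortSign_ne_zero _ _))).symm

theorem ofExponents_injective (n : ℕ) (γ : G) : Function.Injective (P.ofExponents e n γ) := by
  rw [← LinearMap.ker_eq_bot, LinearMap.ker_eq_bot']
  intro v hv
  ext c
  obtain ⟨s, hs⟩ := exists_occurrences_eq ((mem_exponents e).mp c.2).1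
  have := P.ofExponents_basis_of_mem e v c.2 hs
  rw [hv, zero_apply] at this
  exact (smul_eq_zero.mp this.symm).resolve_left (ε.sortSign_ne_zero _ _)

theorem finrank_cochains_eq_sum (hK : (2 : K) ≠ 0) [FiniteDimensional K M] (n : ℕ) (γ : G) :
    Module.finrank K (P.cochains n γ) =
      ∑ c ∈ exponents e n, Module.finrank K (P.deg (γ + ∑ k, c k • e.label k)) := by
  rw [← P.cochains_eq_range e hK, LinearMap.finrank_range_of_inj (P.ofExponents_injective e n γ),
    Module.finrank_pi_fintype]
  exact Finset.sum_coe_sort (exponents e n)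
    fun c => Module.finrank K (P.deg (γ + ∑ k, c k • e.label k))

end ColorModule

/-! ### Real power series with denominator `∏ (1 - X^m)`. -/

namespace PowerSeries

/-- The real power series `p` converges absolutely at `t`. -/
def AbsConvergesAt (t : ℝ) (p : PowerSeries ℝ) : Prop :=
  Summable fun n => ‖coeff n p * t ^ n‖

/-- The sum of the real power series `p` at `t`. -/
noncomputable def sumAt (t : ℝ) (p : PowerSeries ℝ) : ℝ := ∑' n, coeff n p * t ^ n

variable {t : ℝ} {p q : PowerSeries ℝ}

theorem coeff_mul_mul_pow (t : ℝ) (p q : PowerSeries ℝ) (n : ℕ) :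
    coeff n (p * q) * t ^ n =
      ∑ kl ∈ Finset.HasAntidiagonal.antidiagonal n,
        coeff kl.1 p * t ^ kl.1 * (coeff kl.2 q * t ^ kl.2) := by
  rw [coeff_mul, Finset.sum_mul]
  refine Finset.sum_congr rfl fun kl h => ?_
  rw [← Finset.HasAntidiagonal.mem_antidiagonal.mp h, pow_add]
  ring

theorem AbsConvergesAt.mul (hp : AbsConvergesAt t p) (hq : AbsConvergesAt t q) :
    AbsConvergesAt t (p * q) := by
  unfold AbsConvergesAt
  simp only [coeff_mul_mul_pow]
  exact summable_norm_sum_mul_antidiagonal_of_summable_norm (f := fun n => coeff n p * t ^ n)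
    (g := fun n => coeff n q * t ^ n) hp hq

theorem sumAt_mul (hp : AbsConvergesAt t p) (hq : AbsConvergesAt t q) :
    sumAt t (p * q) = sumAt t p * sumAt t q := by
  simp only [sumAt, coeff_mul_mul_pow]
  exact (tsum_mul_tsum_eq_tsum_sum_antidiagonal_of_summable_norm hp hq).symm

theorem absConvergesAt_coe (t : ℝ) (p : Polynomial ℝ) : AbsConvergesAt t (p : PowerSeries ℝ) := by
  refine summable_of_ne_finset_zero (s := p.support) fun n hn => ?_
  rw [Polynomial.coeff_coe, Polynomial.notMem_support_iff.mp hn, zero_mul, norm_zero]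

theorem sumAt_coe (t : ℝ) (p : Polynomial ℝ) : sumAt t (p : PowerSeries ℝ) = p.eval t := by
  rw [sumAt, tsum_eq_sum (s := p.support), Polynomial.eval_eq_sum, Polynomial.sum]
  · simp
  · intro n hn
    rw [Polynomial.coeff_coe, Polynomial.notMem_support_iff.mp hn, zero_mul]

theorem mk_dvd_mul_one_sub_X_pow {m : ℕ} (hm : 0 < m) :
    (mk fun n => if m ∣ n then (1 : ℝ) else 0) * (1 - X ^ m) = 1 := by
  ext n
  rw [mul_sub, mul_one, map_sub, coeff_mul_X_pow', coeff_mk, coeff_one]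
  rcases lt_or_ge n m with h | h
  · rw [if_neg h.not_ge, sub_zero]
    refine if_congr ⟨fun hd => ?_, fun h0 => h0 ▸ dvd_zero m⟩ rfl rfl
    exact Nat.eq_zero_of_dvd_of_lt hd h
  · have hn : n ≠ 0 := by omega
    rw [if_pos h, coeff_mk, if_neg hn]
    simp only [Nat.dvd_sub_iff_left h dvd_rfl, sub_self]

/-- `1 - X^m` is inverted by the geometric series in `X^m`, which converges absolutely for `|t| <
1`. -/
theorem absConvergesAt_of_mul_one_sub_X_pow {m : ℕ} (hm : 0 < m) (ht : t ∈ Set.Ioo (-1 : ℝ) 1)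
    (h : AbsConvergesAt t (p * (1 - X ^ m))) : AbsConvergesAt t p := by
  have hg : AbsConvergesAt t (mk fun n => if m ∣ n then (1 : ℝ) else 0) := by
    refine Summable.of_nonneg_of_le (fun n => norm_nonneg _) (fun n => ?_)
      (summable_geometric_of_lt_one (abs_nonneg t) (abs_lt.mpr ht))
    rw [coeff_mk, norm_mul, norm_pow, Real.norm_eq_abs t]
    refine mul_le_of_le_one_left (by positivity) ?_
    split_ifs <;> simp
  have := h.mul hg
  rwa [mul_assoc, mul_comm (1 - X ^ m), mk_dvd_mul_one_sub_X_pow hm, mul_one] at this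

theorem absConvergesAt_of_mul_prod {ι : Type*} (s : Finset ι) {m : ι → ℕ} (hm : ∀ i ∈ s, 0 < m i)
    (ht : t ∈ Set.Ioo (-1 : ℝ) 1) (h : AbsConvergesAt t (p * ∏ i ∈ s, (1 - X ^ m i))) :
    AbsConvergesAt t p := by
  classical
  induction s using Finset.induction_on generalizing p with
  | empty => simpa using h
  | insert i s hi ih =>
    rw [Finset.prod_insert hi, ← mul_assoc] at h
    exact absConvergesAt_of_mul_one_sub_X_pow (hm i (Finset.mem_insert_self i s)) ht
      (ih (fun j hj => hm j (Finset.mem_insert_of_mem hj)) h)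

theorem sumAt_of_mul_prod_eq_coe {ι : Type*} (s : Finset ι) {m : ι → ℕ} (hm : ∀ i ∈ s, 0 < m i)
    (ht : t ∈ Set.Ioo (-1 : ℝ) 1) {N : Polynomial ℝ} (h : p * ∏ i ∈ s, (1 - X ^ m i) = N) :
    AbsConvergesAt t p ∧ sumAt t p * ∏ i ∈ s, (1 - t ^ m i) = N.eval t := by
  have hp : AbsConvergesAt t p :=
    absConvergesAt_of_mul_prod s hm ht (h ▸ absConvergesAt_coe t N)
  have hw : (∏ i ∈ s, (1 - X ^ m i) : PowerSeries ℝ) =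
      ((∏ i ∈ s, (1 - Polynomial.X ^ m i) : Polynomial ℝ) : PowerSeries ℝ) := by
    rw [← Polynomial.coeToPowerSeries.ringHom_apply, map_prod]
    simp
  refine ⟨hp, ?_⟩
  rw [← sumAt_coe, ← h, hw, sumAt_mul hp (absConvergesAt_coe t _), sumAt_coe,
    Polynomial.eval_prod]
  simp

end PowerSeries

/-! ### Abel limits of series with coefficients in the group ring. -/

namespace AddMonoidAlgebra

variable {H : Type*} [AddCommGroup H]

/-- The polynomial of the coefficients at `β`. -/
noncomputable def coeffPoly (β : H) (N : Polynomial (AddMonoidAlgebra ℝ H)) : Polynomial ℝ :=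
  N.sum fun n c => Polynomial.monomial n (c.coeff β)

theorem coeff_coeffPoly (β : H) (N : Polynomial (AddMonoidAlgebra ℝ H)) (n : ℕ) :
    (coeffPoly β N).coeff n = (N.coeff n).coeff β := by
  rw [coeffPoly, Polynomial.sum, Polynomial.finsetSum_coeff]
  simp only [Polynomial.coeff_monomial]
  rw [Finset.sum_ite_eq' N.support n]
  split_ifs with h
  · rfl
  · rw [Polynomial.notMem_support_iff.mp h]
    rfl

theorem eval_coeffPoly (β : H) (N : Polynomial (AddMonoidAlgebra ℝ H)) (t : ℝ) :
    (coeffPoly β N).eval t = (N.eval (algebraMap ℝ _ t)).coeff β := by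
  rw [coeffPoly, Polynomial.sum, Polynomial.eval_finsetSum, Polynomial.eval_eq_sum,
    Polynomial.sum, coeff_sum, Finsupp.finsetSum_apply]
  refine Finset.sum_congr rfl fun n _ => ?_
  rw [Polynomial.eval_monomial, ← map_pow, mul_comm (N.coeff n), ← Algebra.smul_def, coeff_smul,
    Finsupp.smul_apply, smul_eq_mul, mul_comm]

/-- Taking the coefficient at `β` is only `ℝ`-linear. It commutes with real denominators such as `1
- X^m`, but not with `1 - X e^{-α}`; this is why finite order is used to clear denominators. -/
theorem mk_coeff_mul (β : H) (p : PowerSeries (AddMonoidAlgebra ℝ H)) (w : PowerSeries ℝ) :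
    (PowerSeries.mk fun n => (PowerSeries.coeff n (p * w.map (algebraMap ℝ _))).coeff β) =
      (PowerSeries.mk fun n => (PowerSeries.coeff n p).coeff β) * w := by
  ext n
  rw [PowerSeries.coeff_mk, PowerSeries.coeff_mul, PowerSeries.coeff_mul, coeff_sum,
    Finsupp.finsetSum_apply]
  refine Finset.sum_congr rfl fun kl _ => ?_
  rw [PowerSeries.coeff_map, mul_comm, ← Algebra.smul_def, coeff_smul, Finsupp.smul_apply,
    smul_eq_mul, mul_comm, PowerSeries.coeff_mk]

/-- If the generating series of the `C n` becomes a polynomial when multiplied by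
`∏ (1 - X ^ m i)`, the coefficients of the `C n` have Abel sums in terms of this polynomial. -/
theorem hasEulerChar_of_mul_prod_eq {ι : Type*} (s : Finset ι) {m : ι → ℕ}
    (hm : ∀ i ∈ s, 0 < m i) {C : ℕ → AddMonoidAlgebra ℝ H} {z : ℕ}
    {N : Polynomial (AddMonoidAlgebra ℝ H)}
    (h : PowerSeries.mk C * ∏ i ∈ s, (1 - PowerSeries.X ^ m i) =
      ((1 + Polynomial.X) ^ z * N : Polynomial (AddMonoidAlgebra ℝ H)))
    {κ : ℝ} (hκ : Tendsto (fun t : ℝ => (1 + t) ^ z / ∏ i ∈ s, (1 - t ^ m i)) (𝓝[>] (-1)) (𝓝 κ))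
    {D : ℕ → H → ℕ} (hD : ∀ n β, (C n).coeff β = D n β) :
    HasEulerChar D (κ • N.eval (-1)) := by
  intro β
  have hβ : (PowerSeries.mk fun n => (D n β : ℝ)) * ∏ i ∈ s, (1 - PowerSeries.X ^ m i) =
      (coeffPoly β ((1 + Polynomial.X) ^ z * N) : Polynomial ℝ) := by
    have h1 : (∏ i ∈ s, (1 - PowerSeries.X ^ m i) : PowerSeries (AddMonoidAlgebra ℝ H)) =
        (∏ i ∈ s, (1 - PowerSeries.X ^ m i) : PowerSeries ℝ).map (algebraMap ℝ _) := by
      simp [map_prod]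
    have h2 := mk_coeff_mul β (PowerSeries.mk C) (∏ i ∈ s, (1 - PowerSeries.X ^ m i))
    rw [← h1, h] at h2
    simp only [PowerSeries.coeff_mk, hD] at h2
    rw [← h2]
    ext n
    rw [PowerSeries.coeff_mk, Polynomial.coeff_coe, Polynomial.coeff_coe, coeff_coeffPoly]
  have key := fun t (ht : t ∈ Set.Ioo (-1 : ℝ) 1) =>
    PowerSeries.sumAt_of_mul_prod_eq_coe s hm ht hβ
  refine ⟨fun t ht => ?_, ?_⟩
  · have := (key t ht).1.of_norm
    simpa using this
  · have hlim : Tendsto (fun t : ℝ => (1 + t) ^ z / (∏ i ∈ s, (1 - t ^ m i)) *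
        (coeffPoly β N).eval t) (𝓝[>] (-1)) (𝓝 (κ * (coeffPoly β N).eval (-1))) :=
      hκ.mul ((coeffPoly β N).continuous.tendsto _ |>.mono_left nhdsWithin_le_nhds)
    rw [eval_coeffPoly, map_neg, map_one] at hlim
    refine hlim.congr' ?_
    have hmem : Set.Ioo (-1 : ℝ) 1 ∈ 𝓝[>] (-1 : ℝ) := Ioo_mem_nhdsGT (by norm_num)
    filter_upwards [hmem] with t ht
    have h3 := (key t ht).2
    rw [eval_coeffPoly, Polynomial.eval_mul, Polynomial.eval_pow, Polynomial.eval_add,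
      Polynomial.eval_one, Polynomial.eval_X, ← map_one (algebraMap ℝ (AddMonoidAlgebra ℝ H)),
      ← map_add, ← map_pow, ← Algebra.smul_def, coeff_smul, Finsupp.smul_apply, smul_eq_mul,
      ← eval_coeffPoly] at h3
    -- For `|t| < 1` no denominator vanishes, so the series is the quotient.
    have hne : ∏ i ∈ s, (1 - t ^ m i) ≠ 0 := by
      refine Finset.prod_ne_zero_iff.mpr fun i hi => ?_
      have : |t ^ m i| < 1 := by
        rw [abs_pow]
        exact pow_lt_one₀ (abs_nonneg t) (abs_lt.mpr ht) (hm i hi).ne'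
      have := (abs_lt.mp this).2
      linarith
    rw [div_mul_eq_mul_div, ← h3, mul_div_assoc, div_self hne, mul_one]
    simp [PowerSeries.sumAt]

theorem tendsto_one_add_div_one_sub_pow {m : ℕ} (hm : Even m) (hm0 : 0 < m) :
    Tendsto (fun t : ℝ => (1 + t) / (1 - t ^ m)) (𝓝[>] (-1)) (𝓝 (1 / m)) := by
  have hc : Continuous fun t : ℝ => ∑ j ∈ Finset.range m, (-t) ^ j := by fun_prop
  have h1 := (hc.tendsto (-1)).mono_left (nhdsWithin_le_nhds (s := Set.Ioi (-1)))
  simp only [neg_neg, one_pow, Finset.sum_const, Finset.card_range, nsmul_eq_mul, mul_one] at h1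
  have h2 := h1.inv₀ (by positivity)
  rw [← one_div] at h2
  refine h2.congr' ?_
  filter_upwards [self_mem_nhdsWithin] with t ht
  have ht' : 1 + t ≠ 0 := by
    have : -1 < t := ht
    linarith
  -- For even `m`, `t^m = (-t)^m`, so the geometric sum in `-t` exhibits the simple zero at `-1`;
  -- the cofactor there equals `m`.
  have h3 : 1 - t ^ m = (1 + t) * ∑ j ∈ Finset.range m, (-t) ^ j := by
    have := mul_neg_geom_sum (-t) m
    rw [hm.neg_pow, sub_neg_eq_add] at this
    exact this.symm
  rw [h3, div_mul_cancel_left₀ ht']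

/-- Each simple pole takes up one factor `1 + t`. The surplus gives `0 ^ (z - s.card)`, which is `1`
when the numbers agree and `0` otherwise. -/
theorem tendsto_one_add_pow_div_prod {ι : Type*} (s : Finset ι) {m : ι → ℕ}
    (hm : ∀ i ∈ s, Even (m i) ∧ 0 < m i) {z : ℕ} (hz : s.card ≤ z) :
    Tendsto (fun t : ℝ => (1 + t) ^ z / ∏ i ∈ s, (1 - t ^ m i)) (𝓝[>] (-1))
      (𝓝 (0 ^ (z - s.card) * ∏ i ∈ s, (1 / (m i : ℝ)))) := by
  have hc : Continuous fun t : ℝ => (1 + t) ^ (z - s.card) := by fun_prop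
  have h1 := (hc.tendsto (-1)).mono_left (nhdsWithin_le_nhds (s := Set.Ioi (-1)))
  rw [add_neg_cancel] at h1
  refine (h1.mul (tendsto_finsetProd s fun i hi =>
    tendsto_one_add_div_one_sub_pow (hm i hi).1 (hm i hi).2)).congr fun t => ?_
  rw [Finset.prod_div_distrib, Finset.prod_const, ← mul_div_assoc, ← pow_add,
    Nat.sub_add_cancel hz]

end AddMonoidAlgebra

/-- As `b 0 = 0`, the shifted series sums to `B(t)/t`, so `H(t) = C(t) - B(t) - B(t)/t`. With `B(t)
→ u` the last two terms contribute `-u + u = 0`. -/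
theorem HasAbelLimit.of_eq_add {b c h : ℕ → ℕ} {s u : ℝ} (hb : HasAbelLimit b u)
    (hc : HasAbelLimit c s) (hb0 : b 0 = 0) (heq : ∀ n, c n = h n + b n + b (n + 1)) :
    HasAbelLimit h s := by
  have hterm : ∀ t n, (h n : ℝ) * t ^ n = c n * t ^ n - b n * t ^ n - b (n + 1) * t ^ n := by
    intro t n
    rw [heq n]
    push_cast
    ring
  have hshift : ∀ t ∈ Set.Ioo (-1 : ℝ) 1, t ≠ 0 →
      HasSum (fun n => (b (n + 1) : ℝ) * t ^ n) ((∑' n, (b n : ℝ) * t ^ n) / t) := by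
    intro t ht ht0
    have h1 := (hasSum_nat_add_iff' 1).mpr (hb.1 t ht).hasSum
    have h2 := h1.div_const t
    simp only [Finset.range_one, Finset.sum_singleton, hb0, Nat.cast_zero, zero_mul,
      sub_zero] at h2
    refine (funext fun n => ?_ : (fun n => (b (n + 1) : ℝ) * t ^ n) = _) ▸ h2
    rw [pow_succ]
    field_simp
  refine ⟨fun t ht => ?_, ?_⟩
  -- The division by `t` excludes `t = 0`, where summability is trivial.
  · rcases eq_or_ne t 0 with rfl | ht0
    · refine summable_of_ne_finset_zero (s := {0}) fun n hn => ?_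
      rw [zero_pow (by simpa using hn), mul_zero]
    · simp only [hterm]
      exact ((hc.1 t ht).sub (hb.1 t ht)).sub (hshift t ht ht0).summable
  · have hid : Tendsto (fun t : ℝ => t) (𝓝[>] (-1)) (𝓝 (-1)) := nhdsWithin_le_nhds
    have hlim := (hc.2.sub hb.2).sub (hb.2.div hid (by norm_num))
    have hs : s - u - u / -1 = s := by ring
    rw [hs] at hlim
    refine hlim.congr' ?_
    have hmem : Set.Ioo (-1 : ℝ) 0 ∈ 𝓝[>] (-1 : ℝ) := Ioo_mem_nhdsGT (by norm_num)
    filter_upwards [hmem] with t ht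
    have ht' : t ∈ Set.Ioo (-1 : ℝ) 1 := ⟨ht.1, ht.2.trans one_pos⟩
    have hsum := ((hc.1 t ht').hasSum.sub (hb.1 t ht').hasSum).sub (hshift t ht' ht.2.ne)
    simp only [← hterm] at hsum
    exact hsum.tsum_eq.symm

/-! ### Coarsened dimensions and the passage from cochains to cohomology. -/

namespace ColorModule

variable {G K : Type*} [AddCommGroup G] [Field K] {ε : CommutationFactor G K}
  {L : Type*} [AddCommGroup L] [Module K L] {A : ColorLieAlgebra ε L}
  {M : Type*} [AddCommGroup M] [Module K M] (P : ColorModule A M)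
  (e : HomogeneousBasis A.deg)

/-- `dim C^n_γ`. -/
noncomputable def dimC (n : ℕ) (γ : G) : ℕ := Module.finrank K (P.cochains n γ)

/-- The graded dimension of `M` after coarsening along `p`. -/
noncomputable def gradedDim {H : Type*} (p : G → H) : AddMonoidAlgebra ℝ H :=
  ∑ᶠ α, AddMonoidAlgebra.single (p α) (Module.finrank K (P.deg α) : ℝ)

section Finiteness

variable [FiniteDimensional K M]

theorem finite_support_finrank_deg :
    (Function.support fun α => Module.finrank K (P.deg α)).Finite := by
  refine (WellFoundedGT.finite_ne_bot_of_iSupIndep P.indep).subset fun α hα h => hα ?_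
  simp [h]

theorem gradedDim_coeff {H : Type*} (p : G → H) (β : H) :
    (P.gradedDim p).coeff β = ((∑ᶠ (α : G) (_ : p α = β), Module.finrank K (P.deg α) : ℕ) : ℝ) := by
  classical
  have h := P.finite_support_finrank_deg
  rw [gradedDim, finsum_eq_sum_of_support_subset (s := h.toFinset),
    finsum_eq_sum_of_support_subset (s := h.toFinset), AddMonoidAlgebra.coeff_sum,
    Finsupp.finsetSum_apply, Nat.cast_sum]
  · refine Finset.sum_congr rfl fun α _ => ?_
    rw [AddMonoidAlgebra.coeff_single, Finsupp.single_apply, finsum_eq_if]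
    split_ifs <;> simp
  · intro α hα
    rw [Set.Finite.coe_toFinset]
    intro h0
    simp only [Function.mem_support, finsum_eq_if] at hα
    simp [h0] at hα
  · intro α hα
    rw [Set.Finite.coe_toFinset]
    intro h0
    simp [h0] at hα

/-- Finite support makes the sums in `coarsen` genuine; a `finsum` with infinite support would be
`0` and not additive. -/
theorem finite_support_dimC (hK : (2 : K) ≠ 0) (e : HomogeneousBasis A.deg) (n : ℕ) :
    (Function.support fun γ => P.dimC n γ).Finite := by
  have h : ∀ c ∈ exponents e n, (Function.support fun γ =>
      Module.finrank K (P.deg (γ + ∑ k, c k • e.label k))).Finite := fun c _ =>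
    P.finite_support_finrank_deg.preimage (add_left_injective _).injOn
  refine ((exponents e n).finite_toSet.biUnion h).subset fun γ hγ => ?_
  simp only [Function.mem_support, dimC, P.finrank_cochains_eq_sum e hK] at hγ
  obtain ⟨c, hc, hc'⟩ := Finset.exists_ne_zero_of_sum_ne_zero hγ
  exact Set.mem_biUnion hc hc'

/-- A monomial of total degree `δ` takes values in `M_{γ+δ}` for a cochain of degree `γ`, so it
contributes `e^{-δ} dim M`. This is the origin of the negative exponents. -/
theorem coarsen_dimC {H : Type*} [AddCommGroup H] (hK : (2 : K) ≠ 0) (p : G →+ H) (n : ℕ)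
    (β : H) :
    (∑ c ∈ exponents e n, AddMonoidAlgebra.single (-∑ k, c k • p (e.label k)) (1 : ℝ) *
      P.gradedDim p).coeff β = coarsen p P.dimC n β := by
  classical
  rw [AddMonoidAlgebra.coeff_sum, Finsupp.finsetSum_apply]
  simp only [coarsen, dimC, P.finrank_cochains_eq_sum e hK]
  simp only [finsum_eq_if]
  have hsum (γ : G) : (if p γ = β then ∑ c ∈ exponents e n,
      Module.finrank K (P.deg (γ + ∑ k, c k • e.label k)) else 0) = ∑ c ∈ exponents e n,
      if p γ = β then Module.finrank K (P.deg (γ + ∑ k, c k • e.label k)) else 0 := by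
    split_ifs <;> simp
  simp only [hsum]
  rw [finsum_sum_comm, Nat.cast_sum]
  · refine Finset.sum_congr rfl fun c _ => ?_
    rw [AddMonoidAlgebra.coeff_single_mul_eq_mul_coeff (β + ∑ k, c k • p (e.label k)),
      one_mul, gradedDim_coeff]
    · congr 1
      simp only [finsum_eq_if]
      rw [← finsum_comp_equiv (Equiv.addRight (∑ k, c k • e.label k))]
      refine finsum_congr fun γ => if_congr ?_ rfl rfl
      simp [map_sum]
    · intro γ _
      rw [neg_add_eq_iff_eq_add, add_comm β]
  · intro c _
    refine (P.finite_support_finrank_deg.preimage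
      (add_left_injective (∑ k, c k • e.label k)).injOn).subset fun γ hγ h0 => hγ ?_
    simp only at h0
    simp [h0]

variable [FiniteDimensional K L]

theorem coarsen_dimC_eq (hK : (2 : K) ≠ 0) (e : HomogeneousBasis A.deg) {H : Type*} (p : G → H)
    (n : ℕ) (β : H) : coarsen p P.dimC n β =
      coarsen p P.dimH n β + coarsen p P.dimB n β + coarsen p P.dimB (n + 1) β := by
  have hC := P.finite_support_dimC hK e n
  have hsub (D : G → ℕ) (hD : ∀ γ, D γ ≤ P.dimC n γ) :
      ({γ | p γ = β} ∩ Function.support D).Finite :=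
    hC.subset fun γ hγ h0 => hγ.2 (Nat.eq_zero_of_le_zero (h0 ▸ hD γ))
  have h (γ : G) : P.dimC n γ = P.dimH n γ + P.dimB n γ + P.dimB (n + 1) γ :=
    P.finrank_cochains e n γ
  calc coarsen p P.dimC n β
      = ∑ᶠ γ ∈ {γ | p γ = β}, (P.dimH n γ + P.dimB n γ + P.dimB (n + 1) γ) := by
        simp only [coarsen, h]
        rfl
    _ = _ := by
        rw [finsum_mem_add_distrib' (hsub _ fun γ => by rw [h]; omega)
            (hsub _ fun γ => by rw [h]; omega),
          finsum_mem_add_distrib' (hsub _ fun γ => by rw [h]; omega)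
            (hsub _ fun γ => by rw [h]; omega)]
        rfl

theorem hasEulerChar_dimH (hK : (2 : K) ≠ 0) (e : HomogeneousBasis A.deg) {H : Type*}
    {p : G → H} {b c : AddMonoidAlgebra ℝ H} (hb : HasEulerChar (coarsen p P.dimB) b)
    (hc : HasEulerChar (coarsen p P.dimC) c) : HasEulerChar (coarsen p P.dimH) c := by
  refine fun β => (hb β).of_eq_add (hc β) ?_ fun n => P.coarsen_dimC_eq hK e p n β
  have h (γ : G) : P.dimB 0 γ = 0 := finrank_bot K _
  simp [coarsen, h]

end Finiteness

/-! ### The generating series of the cochains. -/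

section GeneratingSeries

variable {H : Type*} [AddCommGroup H]

open Classical in
/-- The factor of the generating series of the cochains that belongs to a basis vector. -/
noncomputable def basisSeries (p : G →+ H) (i : Fin e.dim) : PowerSeries (AddMonoidAlgebra ℝ H) :=
  PowerSeries.mk fun j => if e.label i ∈ ε.even → j ≤ 1 then
    AddMonoidAlgebra.single (-(j • p (e.label i))) (1 : ℝ) else 0

open PowerSeries in
theorem basisSeries_of_even (p : G →+ H) {i : Fin e.dim} (hi : e.label i ∈ ε.even) :
    basisSeries e p i = ((1 + Polynomial.X * Polynomial.C
      (AddMonoidAlgebra.single (-p (e.label i)) 1) : Polynomial (AddMonoidAlgebra ℝ H)) :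
        PowerSeries (AddMonoidAlgebra ℝ H)) := by
  ext1 j
  rw [basisSeries, PowerSeries.coeff_mk, Polynomial.coeff_coe, Polynomial.coeff_add]
  rcases j with _ | _ | j
  · simp [AddMonoidAlgebra.one_def]
  · simp [Polynomial.coeff_one]
  · rw [if_neg (by simp [hi]), Polynomial.coeff_X_mul, Polynomial.coeff_C]
    simp [Polynomial.coeff_one]

open PowerSeries in
-- The factor is the geometric series in `X e^{-α}`. Since `e^{-mα} = 1`, multiplication by `1 -
-- X^m` truncates it after `m` terms.
theorem basisSeries_of_odd (p : G →+ H) {i : Fin e.dim} (hi : e.label i ∉ ε.even) {m : ℕ}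
    (hm : m • p (e.label i) = 0) :
    basisSeries e p i * (1 - X ^ m) = ((∑ j ∈ Finset.range m, Polynomial.monomial j
      (AddMonoidAlgebra.single (-(j • p (e.label i))) (1 : ℝ)) : Polynomial (AddMonoidAlgebra ℝ H)) :
        PowerSeries (AddMonoidAlgebra ℝ H)) := by
  ext1 n
  rw [mul_sub, mul_one, map_sub, coeff_mul_X_pow', Polynomial.coeff_coe,
    Polynomial.finsetSum_coeff]
  simp only [basisSeries, PowerSeries.coeff_mk, hi, false_imp_iff, if_true, Polynomial.coeff_monomial,
    Finset.sum_ite_eq', Finset.mem_range]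
  rcases lt_or_ge n m with h | h
  · rw [if_neg h.not_ge, if_pos h, sub_zero]
  · rw [if_pos h, if_neg h.not_gt]
    obtain ⟨k, rfl⟩ := Nat.exists_eq_add_of_le h
    rw [Nat.add_sub_cancel_left, add_smul, hm, zero_add, sub_self]

/-- The conditions on an exponent concern each index separately, so the sum over exponents factors.
-/
theorem mk_sum_exponents (p : G →+ H) (D : AddMonoidAlgebra ℝ H) :
    (PowerSeries.mk fun n => ∑ c ∈ exponents e n,
      AddMonoidAlgebra.single (-∑ k, c k • p (e.label k)) (1 : ℝ) * D) =
      (∏ i, basisSeries e p i) * PowerSeries.C D := by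
  classical
  ext1 n
  rw [PowerSeries.coeff_mk, PowerSeries.coeff_mul_C, PowerSeries.coeff_prod, ← Finset.sum_mul]
  congr 1
  simp only [basisSeries, PowerSeries.coeff_mk, Fintype.prod_ite_zero]
  rw [exponents, Finset.sum_filter]
  refine Finset.sum_congr rfl fun c _ => ?_
  by_cases h : ∀ k, e.label k ∈ ε.even → c k ≤ 1
  · rw [if_pos h, if_pos h, ← Finset.sum_neg_distrib]
    exact map_prod (AddMonoidAlgebra.of ℝ H)
      (fun k => Multiplicative.ofAdd (-(c k • p (e.label k)))) Finset.univ
  · rw [if_neg h, if_neg h]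

open Classical in
-- Even vectors whose image degree is `0` give the power of `1 + t`, odd ones the denominators.
-- Everything else is a polynomial `N` that is evaluated at `-1`.
theorem hasEulerChar_dimC [FiniteDimensional K M] [DecidableEq H] (hK : (2 : K) ≠ 0) (p : G →+ H)
    (hfin : ∀ i, e.label i ∉ ε.even → IsOfFinAddOrder (p (e.label i))) {κ : ℝ}
    (hκ : Tendsto (fun t : ℝ =>
      (1 + t) ^ (Finset.univ.filter fun i => e.label i ∈ ε.even ∧ p (e.label i) = 0).card /
        ∏ i with e.label i ∉ ε.even, (1 - t ^ addOrderOf (p (e.label i)))) (𝓝[>] (-1)) (𝓝 κ)) :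
    HasEulerChar (coarsen p P.dimC) (κ •
      ((∏ i with e.label i ∈ ε.even ∧ p (e.label i) ≠ 0,
          (1 - AddMonoidAlgebra.single (-p (e.label i)) (1 : ℝ))) *
        (∏ i with e.label i ∉ ε.even, ∑ j ∈ Finset.range (addOrderOf (p (e.label i))),
          AddMonoidAlgebra.single (-(j • p (e.label i))) ((-1 : ℝ) ^ j)) *
        P.gradedDim p)) := by
  let N : Polynomial (AddMonoidAlgebra ℝ H) :=
    (∏ i with e.label i ∈ ε.even ∧ p (e.label i) ≠ 0,
      (1 + Polynomial.X * Polynomial.C (AddMonoidAlgebra.single (-p (e.label i)) (1 : ℝ)))) *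
    (∏ i with e.label i ∉ ε.even, ∑ j ∈ Finset.range (addOrderOf (p (e.label i))),
      Polynomial.monomial j (AddMonoidAlgebra.single (-(j • p (e.label i))) (1 : ℝ))) *
    Polynomial.C (P.gradedDim p)
  have hN : PowerSeries.mk (fun n => ∑ c ∈ exponents e n,
      AddMonoidAlgebra.single (-∑ k, c k • p (e.label k)) (1 : ℝ) * P.gradedDim p) *
      ∏ i with e.label i ∉ ε.even, (1 - PowerSeries.X ^ addOrderOf (p (e.label i))) =
      ((1 + Polynomial.X) ^
        (Finset.univ.filter fun i => e.label i ∈ ε.even ∧ p (e.label i) = 0).card * N :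
        Polynomial (AddMonoidAlgebra ℝ H)) := by
    have h0 : (∏ i with e.label i ∈ ε.even, (1 + Polynomial.X * Polynomial.C
        (AddMonoidAlgebra.single (-p (e.label i)) (1 : ℝ))) : Polynomial (AddMonoidAlgebra ℝ H)) =
        (1 + Polynomial.X) ^
          (Finset.univ.filter fun i => e.label i ∈ ε.even ∧ p (e.label i) = 0).card *
        ∏ i with e.label i ∈ ε.even ∧ p (e.label i) ≠ 0,
          (1 + Polynomial.X * Polynomial.C (AddMonoidAlgebra.single (-p (e.label i)) (1 : ℝ))) := by
      rw [← Finset.prod_filter_mul_prod_filter_not _ fun i => p (e.label i) = 0,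
        Finset.filter_filter, Finset.filter_filter, ← Finset.prod_const]
      congr 1
      refine Finset.prod_congr rfl fun i hi => ?_
      rw [(Finset.mem_filter.mp hi).2.2, neg_zero, ← AddMonoidAlgebra.one_def, map_one, mul_one]
    rw [mk_sum_exponents, ← Finset.prod_filter_mul_prod_filter_not Finset.univ
      (fun i => e.label i ∈ ε.even) (basisSeries e p), mul_right_comm, mul_assoc (∏ i with _, _),
      ← Finset.prod_mul_distrib, Finset.prod_congr rfl fun i hi =>
        basisSeries_of_even e p (Finset.mem_filter.mp hi).2,
      Finset.prod_congr rfl fun i hi => basisSeries_of_odd e p (Finset.mem_filter.mp hi).2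
        (addOrderOf_nsmul_eq_zero _)]
    rw [← Polynomial.coe_C]
    simp only [← Polynomial.coeToPowerSeries.ringHom_apply, ← map_prod, ← map_mul]
    rw [h0]
    congr 1
    simp only [N, mul_assoc]
  have := AddMonoidAlgebra.hasEulerChar_of_mul_prod_eq _ (fun i hi => addOrderOf_pos_iff.mpr
    (hfin i (Finset.mem_filter.mp hi).2)) hN hκ (P.coarsen_dimC e hK p)
  convert this using 2
  simp only [N, Polynomial.eval_mul, Polynomial.eval_prod, Polynomial.eval_add,
    Polynomial.eval_one, Polynomial.eval_X, Polynomial.eval_C, Polynomial.eval_finsetSum,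
    Polynomial.eval_monomial, neg_mul, one_mul, ← sub_eq_add_neg]
  congr 2
  refine Finset.prod_congr rfl fun i _ => Finset.sum_congr rfl fun j _ => ?_
  rcases Nat.even_or_odd j with hj | hj <;> simp [hj.neg_one_pow]

end GeneratingSeries

end ColorModule

/-! ### The idempotents `χ̄(α)`. -/

section ChiBar

variable {H : Type*} [AddCommGroup H]

theorem AddMonoidAlgebra.single_neg_one_pow (a : H) (j : ℕ) :
    (AddMonoidAlgebra.single a (-1 : ℝ)) ^ j = AddMonoidAlgebra.single (j • a) ((-1) ^ j) :=
  AddMonoidAlgebra.single_pow ..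

theorem mul_sum_range_pow_of_pow_eq_one {R : Type*} [CommRing R] {u : R} {m : ℕ} (hu : u ^ m = 1) :
    u * ∑ j ∈ Finset.range m, u ^ j = ∑ j ∈ Finset.range m, u ^ j := by
  have h := mul_neg_geom_sum u m
  rw [hu, sub_self, sub_mul, one_mul, sub_eq_zero] at h
  exact h.symm

/-- The sum of the powers of `v` is fixed by `u = v⁻¹`; multiplying it by `u^(m-1)` reverses it into
the sum of the powers of `u`. -/
theorem sum_range_pow_eq_of_mul_eq_one {R : Type*} [CommRing R] {u v : R} {m : ℕ} (hv : v ^ m = 1)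
    (huv : u * v = 1) :
    ∑ j ∈ Finset.range m, v ^ j = ∑ j ∈ Finset.range m, u ^ j := by
  have h1 : u * ∑ j ∈ Finset.range m, v ^ j = ∑ j ∈ Finset.range m, v ^ j := by
    nth_rewrite 1 [← mul_sum_range_pow_of_pow_eq_one hv]
    rw [← mul_assoc, huv, one_mul]
  have h2 : ∀ k, u ^ k * ∑ j ∈ Finset.range m, v ^ j = ∑ j ∈ Finset.range m, v ^ j := by
    intro k
    induction k with
    | zero => rw [pow_zero, one_mul]
    | succ k ih => rw [pow_succ, mul_assoc, h1, ih]
  rw [← h2 (m - 1), ← Finset.sum_range_reflect (fun j => u ^ j), Finset.mul_sum]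
  refine Finset.sum_congr rfl fun j hj => ?_
  obtain ⟨k, hk⟩ := Nat.exists_eq_add_of_le (Nat.le_sub_one_of_lt (Finset.mem_range.mp hj))
  rw [hk, Nat.add_sub_cancel_left, pow_add, mul_right_comm, ← mul_pow, huv, one_pow, one_mul]

theorem chiBar_eq_smul_sum (a : H) : chiBar a = (1 / (addOrderOf a : ℝ)) •
    ∑ j ∈ Finset.range (addOrderOf a), AddMonoidAlgebra.single a (-1 : ℝ) ^ j := by
  simp only [chiBar, AddMonoidAlgebra.single_neg_one_pow]

theorem single_neg_one_pow_addOrderOf {a : H} (ha : Even (addOrderOf a)) :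
    AddMonoidAlgebra.single a (-1 : ℝ) ^ addOrderOf a = 1 := by
  rw [AddMonoidAlgebra.single_neg_one_pow, addOrderOf_nsmul_eq_zero, ha.neg_one_pow,
    AddMonoidAlgebra.one_def]

/-- `χ̄(-a) = χ̄(a)`, which removes the signs of the exponents coming from the cochains. Even order
ensures that `(-e^a)^m = 1`. -/
theorem smul_sum_single_neg_eq_chiBar {a : H} (ha : Even (addOrderOf a)) :
    (1 / (addOrderOf a : ℝ)) • ∑ j ∈ Finset.range (addOrderOf a),
      AddMonoidAlgebra.single (-(j • a)) ((-1 : ℝ) ^ j) = chiBar a := by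
  have hv : AddMonoidAlgebra.single (-a) (-1 : ℝ) ^ addOrderOf a = 1 := by
    rw [← addOrderOf_neg a] at ha ⊢
    exact single_neg_one_pow_addOrderOf ha
  have huv : AddMonoidAlgebra.single a (-1 : ℝ) * AddMonoidAlgebra.single (-a) (-1 : ℝ) = 1 := by
    rw [AddMonoidAlgebra.single_mul_single, add_neg_cancel, AddMonoidAlgebra.one_def]
    norm_num
  rw [chiBar_eq_smul_sum, ← sum_range_pow_eq_of_mul_eq_one hv huv]
  simp only [AddMonoidAlgebra.single_neg_one_pow, smul_neg]

/-- With `u = -e^a` and `u^m = 1`, the sum `s` of the powers of `u` satisfies `u s = s`, hence `s² =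
m s`. -/
theorem isIdempotentElem_chiBar {a : H} (ha : Even (addOrderOf a)) (ha0 : 0 < addOrderOf a) :
    IsIdempotentElem (chiBar a) := by
  rw [chiBar_eq_smul_sum]
  set u := AddMonoidAlgebra.single a (-1 : ℝ)
  set s := ∑ j ∈ Finset.range (addOrderOf a), u ^ j with hs
  have h1 : u * s = s := mul_sum_range_pow_of_pow_eq_one (single_neg_one_pow_addOrderOf ha)
  have h2 : ∀ k, u ^ k * s = s := by
    intro k
    induction k with
    | zero => rw [pow_zero, one_mul]
    | succ k ih => rw [pow_succ, mul_assoc, h1, ih]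
  have h3 : s * s = (addOrderOf a : ℝ) • s := by
    nth_rewrite 1 [hs]
    rw [Finset.sum_mul, Finset.sum_congr rfl fun k _ => h2 k, Finset.sum_const,
      Finset.card_range, Nat.cast_smul_eq_nsmul]
  have ha' : (addOrderOf a : ℝ) ≠ 0 := Nat.cast_ne_zero.mpr ha0.ne'
  rw [IsIdempotentElem, smul_mul_smul_comm, h3, smul_smul]
  congr 1
  field_simp

theorem IsIdempotentElem.pow_eq_pow {R : Type*} [Monoid R] {x : R} (hx : IsIdempotentElem x)
    {m n : ℕ} (h : m = 0 ↔ n = 0) : x ^ m = x ^ n := by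
  rcases m with _ | m
  · rw [h.mp rfl]
  · obtain ⟨n, rfl⟩ := Nat.exists_eq_succ_of_ne_zero (mt h.mpr m.succ_ne_zero)
    rw [hx.pow_succ_eq, hx.pow_succ_eq]

theorem chiBar_one_zmod_two : chiBar (1 : ZMod 2) =
    (1 / 2 : ℝ) • (1 - AddMonoidAlgebra.single (1 : ZMod 2) (1 : ℝ)) := by
  rw [chiBar, ZMod.addOrderOf_one, Finset.sum_range_succ, Finset.sum_range_one]
  simp [AddMonoidAlgebra.one_def, sub_eq_add_neg]

end ChiBar

/-! ### Parity. -/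

namespace CommutationFactor

variable {G K : Type*} [AddCommGroup G] [Field K] (ε : CommutationFactor G K)

theorem nsmul_left (n : ℕ) (α β : G) : ε (n • α) β = ε α β ^ n := by
  induction n with
  | zero => rw [zero_smul, ε.zero_left, pow_zero]
  | succ n ih => rw [succ_nsmul, ε.add_left, ih, pow_succ]

variable {ε}

theorem mem_odd_iff (hK : (2 : K) ≠ 0) {α : G} : α ∈ ε.odd ↔ α ∉ ε.even := by
  refine ⟨fun h h' => hK ?_, ε.self_eq_neg_one⟩
  have h1 : ε α α = 1 := h'
  have h2 : ε α α = -1 := h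
  rw [h1] at h2
  linear_combination h2

theorem even_addOrderOf (hK : (2 : K) ≠ 0) {α : G} (h : α ∉ ε.even) : Even (addOrderOf α) := by
  have h1 := ε.nsmul_left (addOrderOf α) α α
  rw [addOrderOf_nsmul_eq_zero, ε.zero_left, ε.self_eq_neg_one h] at h1
  by_contra hodd
  rw [(Nat.not_even_iff_odd.mp hodd).neg_one_pow] at h1
  exact hK (by linear_combination h1)

variable (ε) in
/-- The parity map as a homomorphism. -/
noncomputable def parityHom : G →+ ZMod 2 where
  toFun := ε.parity
  map_zero' := if_pos (ε.zero_left 0)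
  map_add' α β := by
    -- The cross terms `ε(α, β) ε(β, α)` cancel, so `α ↦ ε(α, α)` is a character.
    have h : ε (α + β) (α + β) = ε α α * ε β β := by
      rw [ε.add_left, ε.add_right, ε.add_right]
      linear_combination ε α α * ε β β * ε.mul_swap α β
    by_cases hα : ε α α = 1 <;> by_cases hβ : ε β β = 1
    · simp [parity, even, h, hα, hβ]
    · simp [parity, even, h, hα, hβ]
    · simp [parity, even, h, hα, hβ]
    · have h1 : ε (α + β) (α + β) = 1 := by
        rw [h, ε.self_eq_neg_one hα, ε.self_eq_neg_one hβ]
        ring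
      have e1 : ε.parity (α + β) = 0 := if_pos h1
      have e2 : ε.parity α = 1 := if_neg hα
      have e3 : ε.parity β = 1 := if_neg hβ
      rw [e1, e2, e3]
      decide

end CommutationFactor

namespace HomogeneousBasis

variable {G K V : Type*} [Field K] [AddCommGroup V] [Module K V] {deg : G → Submodule K V}

theorem finsum_finrank_deg (e : HomogeneousBasis deg) :
    ∑ᶠ α, Module.finrank K (deg α) = Module.finrank K V := by
  classical
  rw [finsum_eq_sum_of_support_subset (s := Finset.univ.image e.label)]
  · simp only [e.finrank_deg]
    rw [← Finset.card_eq_sum_card_image, Finset.card_univ,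
      ← Module.finrank_eq_card_basis e.basis]
  · intro α hα
    rw [Function.mem_support, e.finrank_deg, ← Nat.pos_iff_ne_zero, Finset.card_pos] at hα
    obtain ⟨i, hi⟩ := hα
    simpa using ⟨i, by simpa using hi⟩

end HomogeneousBasis

/-! ### The three gradings and the theorem. -/

namespace ColorModule

variable {G K : Type*} [AddCommGroup G] [Field K] {ε : CommutationFactor G K}
  {L : Type*} [AddCommGroup L] [Module K L] {A : ColorLieAlgebra ε L}
  {M : Type*} [AddCommGroup M] [Module K M] (P : ColorModule A M)
  (e : HomogeneousBasis A.deg)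

open Classical in
-- Every odd vector has a simple pole at `-1`, and `r ≤ z` allows all of them to be cancelled. The
-- limits `1/m` turn the truncated geometric sums at `-1` into `χ̄`.
theorem hasEulerChar_of_even_order [FiniteDimensional K L] [FiniteDimensional K M]
    {H : Type*} [AddCommGroup H] [DecidableEq H] (hK : (2 : K) ≠ 0) (p : G →+ H)
    (hp : ∀ i, e.label i ∉ ε.even →
      Even (addOrderOf (p (e.label i))) ∧ 0 < addOrderOf (p (e.label i)))
    {b : AddMonoidAlgebra ℝ H} (hb : HasEulerChar (coarsen p P.dimB) b) {z r : ℕ}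
    (hz : (Finset.univ.filter fun i => e.label i ∈ ε.even ∧ p (e.label i) = 0).card = z)
    (hr : (Finset.univ.filter fun i => e.label i ∉ ε.even).card = r) (hrz : r ≤ z) :
    HasEulerChar (coarsen p P.dimH) ((0 ^ (z - r) : ℝ) •
      ((∏ i with e.label i ∈ ε.even ∧ p (e.label i) ≠ 0,
          (1 - AddMonoidAlgebra.single (-p (e.label i)) (1 : ℝ))) *
        (∏ i with e.label i ∉ ε.even, chiBar (p (e.label i))) * P.gradedDim p)) := by
  have hκ := AddMonoidAlgebra.tendsto_one_add_pow_div_prod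
    (Finset.univ.filter fun i => e.label i ∉ ε.even) (m := fun i => addOrderOf (p (e.label i)))
    (fun i hi => hp i (Finset.mem_filter.mp hi).2) (hr.trans_le hrz)
  rw [← hz] at hκ
  have := P.hasEulerChar_dimH hK e hb (P.hasEulerChar_dimC e hK p
    (fun i hi => addOrderOf_pos_iff.mp (hp i hi).2) hκ)
  convert this using 1
  rw [hz, hr, mul_smul]
  congr 1
  rw [← smul_mul_assoc, ← mul_smul_comm]
  congr 2
  rw [← Finset.prod_smul]
  refine Finset.prod_congr rfl fun i hi => ?_
  have := hp i (Finset.mem_filter.mp hi).2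
  exact (smul_sum_single_neg_eq_chiBar this.1).symm

open Classical in
theorem hasAbelLimit_totalDim_dimH [FiniteDimensional K L] [FiniteDimensional K M]
    (hK : (2 : K) ≠ 0) {b : ℝ}
    (hb : HasAbelLimit (totalDim P.dimB) b) :
    HasAbelLimit (totalDim P.dimH)
      (0 ^ (Finset.univ.filter fun i => e.label i ∈ ε.even).card *
        ((Module.finrank K M : ℝ) /
          2 ^ (Finset.univ.filter fun i => e.label i ∉ ε.even).card)) := by
  have hcoarsen (D : ℕ → G → ℕ) (n : ℕ) (β : Unit) :
      coarsen (0 : G →+ Unit) D n β = totalDim D n := by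
    simp [coarsen, totalDim]
  have hb' : HasEulerChar (coarsen (0 : G →+ Unit) P.dimB) (AddMonoidAlgebra.single () b) := by
    intro β
    simpa only [hcoarsen, AddMonoidAlgebra.coeff_single, Finsupp.single_eq_same] using hb
  have hκ : Tendsto (fun t : ℝ => (1 + t) ^ (Finset.univ.filter fun i =>
      e.label i ∈ ε.even ∧ (0 : G →+ Unit) (e.label i) = 0).card /
        ∏ i with e.label i ∉ ε.even, (1 - t ^ addOrderOf ((0 : G →+ Unit) (e.label i))))
      (𝓝[>] (-1)) (𝓝 (0 ^ (Finset.univ.filter fun i => e.label i ∈ ε.even).card /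
        2 ^ (Finset.univ.filter fun i => e.label i ∉ ε.even).card)) := by
    simp only [AddMonoidHom.zero_apply, and_true, addOrderOf_zero, pow_one, Finset.prod_const]
    set z := (Finset.univ.filter fun i => e.label i ∈ ε.even).card
    set r := (Finset.univ.filter fun i => e.label i ∉ ε.even).card
    -- The denominator equals `2 ^ r` at `-1`, so no comparison of dimensions is needed.
    have hc : ContinuousAt (fun t : ℝ => (1 + t) ^ z / (1 - t) ^ r) (-1) := by
      refine ContinuousAt.div (by fun_prop) (by fun_prop) ?_
      norm_num
    have := hc.tendsto.mono_left (nhdsWithin_le_nhds (s := Set.Ioi (-1)))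
    norm_num at this
    exact this
  have := P.hasEulerChar_dimH hK e hb' (P.hasEulerChar_dimC e hK 0
    (fun i _ => IsOfFinAddOrder.zero) hκ) ()
  simp only [hcoarsen] at this
  convert this using 1
  obtain ⟨e'⟩ := HomogeneousBasis.nonempty_of_iSupIndep P.indep P.iSup_eq_top
  have hM : (P.gradedDim (0 : G →+ Unit)).coeff () = Module.finrank K M := by
    rw [gradedDim_coeff, ← e'.finsum_finrank_deg]
    simp
  have hE : ∏ i with e.label i ∈ ε.even ∧ (0 : G →+ Unit) (e.label i) ≠ 0,
      (1 - AddMonoidAlgebra.single (-(0 : G →+ Unit) (e.label i)) (1 : ℝ)) = 1 := by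
    rw [Finset.filter_false_of_mem fun i _ h => h.2 rfl, Finset.prod_empty]
  have hO : ∏ i with e.label i ∉ ε.even,
      ∑ j ∈ Finset.range (addOrderOf ((0 : G →+ Unit) (e.label i))),
        AddMonoidAlgebra.single (-(j • (0 : G →+ Unit) (e.label i))) ((-1 : ℝ) ^ j) = 1 := by
    refine Finset.prod_eq_one fun i _ => ?_
    rw [AddMonoidHom.zero_apply, addOrderOf_zero, Finset.sum_range_one, zero_smul, neg_zero,
      pow_zero, AddMonoidAlgebra.one_def]
  rw [hE, hO, one_mul, one_mul, AddMonoidAlgebra.coeff_smul, Finsupp.smul_apply, hM, smul_eq_mul]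
  ring

open Classical in
theorem hasEulerChar_parity_dimH [FiniteDimensional K L] [FiniteDimensional K M]
    (hK : (2 : K) ≠ 0) {b : AddMonoidAlgebra ℝ (ZMod 2)}
    (hb : HasEulerChar (coarsen ε.parity P.dimB) b) {z r : ℕ}
    (hz : (Finset.univ.filter fun i => e.label i ∈ ε.even).card = z)
    (hr : (Finset.univ.filter fun i => e.label i ∉ ε.even).card = r) (hrz : r ≤ z) :
    HasEulerChar (coarsen ε.parity P.dimH) ((0 ^ (z - r) : ℝ) •
      (((1 / 2 : ℝ) • (1 - AddMonoidAlgebra.single (1 : ZMod 2) (1 : ℝ))) ^ r * P.superDim)) := by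
  have heven (i) (hi : e.label i ∈ ε.even) : ε.parityHom (e.label i) = 0 := if_pos hi
  have hodd (i) (hi : e.label i ∉ ε.even) : ε.parityHom (e.label i) = 1 := if_neg hi
  have hord : addOrderOf (1 : ZMod 2) = 2 := ZMod.addOrderOf_one 2
  have hz' : (Finset.univ.filter fun i =>
      e.label i ∈ ε.even ∧ ε.parityHom (e.label i) = 0).card = z := by
    rw [← hz]
    congr 1
    exact Finset.filter_congr fun i _ => and_iff_left_of_imp (heven i)
  have := P.hasEulerChar_of_even_order e hK ε.parityHom
    (fun i hi => by rw [hodd i hi, hord]; decide) hb hz' hr hrz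
  change HasEulerChar (coarsen ε.parityHom P.dimH) _
  convert this using 2
  rw [Finset.filter_false_of_mem fun i _ h => h.2 (heven i h.1), Finset.prod_empty, one_mul,
    Finset.prod_congr rfl fun i hi => congrArg chiBar (hodd i (Finset.mem_filter.mp hi).2),
    Finset.prod_const, chiBar_one_zmod_two, hr]
  rfl

theorem oddSupport_eq [FiniteDimensional K L] [DecidableEq G] [DecidablePred (· ∈ ε.even)]
    (hK : (2 : K) ≠ 0) :
    A.oddSupport = ((Finset.univ.filter fun i => e.label i ∉ ε.even).image e.label : Finset G) := by
  ext α
  have h : A.deg α ≠ ⊥ ↔ ∃ i, e.label i = α := by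
    rw [← Submodule.one_le_finrank_iff, Nat.one_le_iff_ne_zero, ← Nat.pos_iff_ne_zero,
      e.finrank_deg, Finset.card_pos]
    simp [Finset.Nonempty]
  simp only [ColorLieAlgebra.oddSupport, Set.mem_ofPred_eq, CommutationFactor.mem_odd_iff hK, h,
    Finset.coe_image, Set.mem_image, Finset.mem_coe, Finset.mem_filter, Finset.mem_univ, true_and]
  constructor
  · rintro ⟨h1, i, rfl⟩
    exact ⟨i, h1, rfl⟩
  · rintro ⟨i, h1, rfl⟩
    exact ⟨h1, i, rfl⟩

open Classical in
-- Grouping the basis vectors by degree gives powers of `χ̄(α)` with positive exponents, which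
-- idempotence reduces to `χ̄(α)`.
theorem prod_chiBar_eq [FiniteDimensional K L] (hK : (2 : K) ≠ 0)
    (hfin : ∀ α ∈ A.oddSupport, IsOfFinAddOrder α) :
    ∏ i with e.label i ∉ ε.even, chiBar (e.label i) =
      ∏ᶠ (α : G) (_ : α ∈ A.oddSupport), chiBar α := by
  have hS := oddSupport_eq e hK
  rw [Finset.prod_comp, hS]
  change _ = ∏ᶠ α ∈ (((Finset.univ.filter fun i => e.label i ∉ ε.even).image e.label :
    Finset G) : Set G), chiBar α
  rw [finprod_mem_coe_finset]
  refine Finset.prod_congr rfl fun α hα => ?_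
  have hα' : α ∈ A.oddSupport := by rw [hS]; exact hα
  have hid : IsIdempotentElem (chiBar α) := isIdempotentElem_chiBar
    (CommutationFactor.even_addOrderOf hK ((CommutationFactor.mem_odd_iff hK).mp hα'.1))
    (addOrderOf_pos_iff.mpr (hfin α hα'))
  conv_rhs => rw [← pow_one (chiBar α)]
  refine hid.pow_eq_pow ?_
  obtain ⟨i, hi, rfl⟩ := Finset.mem_image.mp hα
  simp only [one_ne_zero, iff_false]
  exact Finset.card_ne_zero_of_mem (Finset.mem_filter.mpr ⟨hi, rfl⟩)

open Classical in
theorem prod_one_sub_eq : ∏ i with e.label i ∈ ε.even ∧ e.label i ≠ 0,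
      (1 - AddMonoidAlgebra.single (-e.label i) (1 : ℝ)) =
    ∏ᶠ (α : G) (_ : α ≠ 0 ∧ α ∈ ε.even),
      (1 - AddMonoidAlgebra.single (-α) (1 : ℝ)) ^ Module.finrank K (A.deg α) := by
  rw [Finset.prod_comp (fun α => 1 - AddMonoidAlgebra.single (-α) (1 : ℝ)) e.label,
    finprod_eq_prod_of_mulSupport_subset (s := (Finset.univ.filter fun i =>
      e.label i ∈ ε.even ∧ e.label i ≠ 0).image e.label)]
  · refine Finset.prod_congr rfl fun α hα => ?_
    obtain ⟨i, hi, rfl⟩ := Finset.mem_image.mp hα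
    have hi' := (Finset.mem_filter.mp hi).2
    rw [finprod_eq_if, if_pos hi'.symm, e.finrank_deg, Finset.filter_filter]
    congr 2
    refine Finset.filter_congr fun j _ => ⟨fun h => h.2, fun h => ⟨h ▸ hi', h⟩⟩
  · intro α hα
    rw [Function.mem_mulSupport, finprod_eq_if] at hα
    split_ifs at hα with h
    · have h0 : Module.finrank K (A.deg α) ≠ 0 := fun h0 => hα (by rw [h0, pow_zero])
      rw [e.finrank_deg] at h0
      obtain ⟨i, hi⟩ := Finset.card_pos.mp (Nat.pos_of_ne_zero h0)
      obtain rfl := (Finset.mem_filter.mp hi).2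
      exact Finset.mem_coe.mpr (Finset.mem_image_of_mem _ (by simp [h]))
    · exact absurd rfl hα

open Classical in
theorem hasEulerChar_color_dimH [FiniteDimensional K L] [FiniteDimensional K M]
    (hK : (2 : K) ≠ 0)
    (hfin : ∀ α ∈ A.oddSupport, IsOfFinAddOrder α) {b : AddMonoidAlgebra ℝ G}
    (hb : HasEulerChar P.dimB b) {r : ℕ}
    (hr : (Finset.univ.filter fun i => e.label i ∉ ε.even).card = r)
    (hrz : r ≤ Module.finrank K (A.deg 0)) :
    HasEulerChar P.dimH ((0 ^ (Module.finrank K (A.deg 0) - r) : ℝ) •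
      ((∏ᶠ (α : G) (_ : α ≠ 0 ∧ α ∈ ε.even),
          (1 - AddMonoidAlgebra.single (-α) (1 : ℝ)) ^ Module.finrank K (A.deg α)) *
        (∏ᶠ (α : G) (_ : α ∈ A.oddSupport), chiBar α) * P.colorDim)) := by
  have hcoarsen (D : ℕ → G → ℕ) : coarsen (AddMonoidHom.id G) D = D := by
    ext n β
    simp [coarsen]
  have hz : (Finset.univ.filter fun i => e.label i ∈ ε.even ∧
      AddMonoidHom.id G (e.label i) = 0).card = Module.finrank K (A.deg 0) := by
    rw [e.finrank_deg]
    congr 1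
    refine Finset.filter_congr fun i _ => ⟨fun h => h.2, fun h => ⟨?_, h⟩⟩
    rw [h]
    exact ε.zero_left 0
  have hp (i) (hi : e.label i ∉ ε.even) : Even (addOrderOf (AddMonoidHom.id G (e.label i))) ∧
      0 < addOrderOf (AddMonoidHom.id G (e.label i)) := by
    refine ⟨CommutationFactor.even_addOrderOf hK hi, addOrderOf_pos_iff.mpr (hfin _ ?_)⟩
    rw [oddSupport_eq e hK]
    exact Finset.mem_coe.mpr (Finset.mem_image_of_mem _ (by simpa using hi))
  have := P.hasEulerChar_of_even_order e hK (AddMonoidHom.id G) hp (by rwa [hcoarsen]) hz hr hrz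
  rw [hcoarsen] at this
  rw [← prod_chiBar_eq e hK hfin, ← prod_one_sub_eq e]
  exact this

end ColorModule

theorem theorem1 {G K L M : Type*} [AddCommGroup G] [Field K] (hK : (2 : K) ≠ 0)
    (ε : CommutationFactor G K)
    [AddCommGroup L] [Module K L] [FiniteDimensional K L] (A : ColorLieAlgebra ε L)
    [AddCommGroup M] [Module K M] [FiniteDimensional K M] (P : ColorModule A M) :
    ((∃ b, HasAbelLimit (totalDim P.dimB) b) →
      (A.evenPart ≠ ⊥ → HasAbelLimit (totalDim P.dimH) 0) ∧
      (A.evenPart = ⊥ → HasAbelLimit (totalDim P.dimH)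
        ((Module.finrank K M : ℝ) / 2 ^ Module.finrank K A.oddPart))) ∧
    ((∃ b, HasEulerChar (coarsen ε.parity P.dimB) b) →
      (Module.finrank K A.oddPart < Module.finrank K A.evenPart →
        HasEulerChar (coarsen ε.parity P.dimH) 0) ∧
      (Module.finrank K A.evenPart = Module.finrank K A.oddPart →
        HasEulerChar (coarsen ε.parity P.dimH)
          (((1 / 2 : ℝ) • (1 - AddMonoidAlgebra.single (1 : ZMod 2) (1 : ℝ))) ^
            A.oddSupport.ncard * P.superDim))) ∧
    ((∀ α ∈ A.oddSupport, IsOfFinAddOrder α) → (∃ b, HasEulerChar P.dimB b) →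
      (Module.finrank K A.oddPart < Module.finrank K (A.deg 0) →
        HasEulerChar P.dimH 0) ∧
      (Module.finrank K (A.deg 0) = Module.finrank K A.oddPart →
        HasEulerChar P.dimH
          ((∏ᶠ (α : G) (_ : α ≠ 0 ∧ α ∈ ε.even),
              (1 - AddMonoidAlgebra.single (-α) (1 : ℝ)) ^ Module.finrank K (A.deg α)) *
            (∏ᶠ (α : G) (_ : α ∈ A.oddSupport), chiBar α) * P.colorDim))) := by
  classical
  obtain ⟨e⟩ := HomogeneousBasis.nonempty_of_iSupIndep A.indep A.iSup_eq_top
  have hev : (Finset.univ.filter fun i => e.label i ∈ ε.even).card =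
      Module.finrank K A.evenPart := (e.finrank_iSup_deg ε.even).symm
  have hod : (Finset.univ.filter fun i => e.label i ∉ ε.even).card =
      Module.finrank K A.oddPart := by
    rw [ColorLieAlgebra.oddPart, e.finrank_iSup_deg ε.odd]
    congr 1
    exact Finset.filter_congr fun i _ => (CommutationFactor.mem_odd_iff hK).symm
  refine ⟨?_, ?_, ?_⟩
  · rintro ⟨b, hb⟩
    have h := P.hasAbelLimit_totalDim_dimH e hK hb
    rw [hev, hod] at h
    refine ⟨fun h0 => ?_, fun h0 => ?_⟩
    · rwa [zero_pow (mt Submodule.finrank_eq_zero.mp h0), zero_mul] at h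
    · rwa [h0, finrank_bot, pow_zero, one_mul] at h
  · rintro ⟨b, hb⟩
    refine ⟨fun hlt => ?_, fun heq => ?_⟩
    · have h := P.hasEulerChar_parity_dimH e hK hb hev hod hlt.le
      rwa [zero_pow (Nat.sub_ne_zero_of_lt hlt), zero_smul] at h
    · have h := P.hasEulerChar_parity_dimH e hK hb hev hod heq.ge
      rw [heq, Nat.sub_self, pow_zero, one_smul] at h
      have hid : IsIdempotentElem
          ((1 / 2 : ℝ) • (1 - AddMonoidAlgebra.single (1 : ZMod 2) (1 : ℝ))) := by
        rw [← chiBar_one_zmod_two]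
        exact isIdempotentElem_chiBar (by rw [ZMod.addOrderOf_one]; decide)
          (by rw [ZMod.addOrderOf_one]; decide)
      -- By idempotence the exponent `dim L_odd` may be replaced by the number of odd degrees: one
      -- vanishes exactly when the other does.
      rwa [hid.pow_eq_pow (n := A.oddSupport.ncard)] at h
      rw [ColorModule.oddSupport_eq e hK, Set.ncard_coe_finset, ← hod, Finset.card_eq_zero,
        Finset.card_eq_zero, Finset.image_eq_empty]
  · rintro hfin ⟨b, hb⟩
    refine ⟨fun hlt => ?_, fun heq => ?_⟩
    · have h := P.hasEulerChar_color_dimH e hK hfin hb hod hlt.le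
      rwa [zero_pow (Nat.sub_ne_zero_of_lt hlt), zero_smul] at h
    · have h := P.hasEulerChar_color_dimH e hK hfin hb hod heq.ge
      rwa [heq, Nat.sub_self, pow_zero, one_smul] at h
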